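/- Theorem (existence of a pinned solution for the Quenched Edwards–Wilkinson equation). Let $n\ge 1$, let $(\Omega,\mathcal F,\mathbb P)$ be a probability space, let $r_1>\sqrt n\,r_0>0$, and let $\phi\in C^\infty(\mathbb R^n\times\mathbb R)$ satisfy $\phi\le 0$, $\phi(x,y)=0$ whenever the Euclidean norm of $(x,y)\in\mathbb R^{n+1}$ exceeds $r_1$, and $\phi(x,y)\le -1$ whenever the maximum norm of $(x,y)$ is at most $r_0$. Let the random points $(x_k,y_k)_{k\in\mathbb N}$ form an $(n+1)$-dimensional Poisson process on $\mathbb R^n\times[r_1,\infty)$ with intensity $\lambda>0$, let $(f_k)_{k\in\mathbb N}$ be iid (almost surely) strictly positive random variables independent of $(x_k,y_k)_{k\in\mathbb N}$, and put $$f(x,y,\omega)=\sum_{k} f_k(\omega)\,\phi\bigl(x-x_k(\omega),\,y-y_k(\omega)\bigr).$$ Then there exist a deterministic constant $F^*>0$ and a random function $v:\mathbb R^n\times\Omega\to[0,\infty)$ such that, almost surely, $v(\cdot,\omega)$ is continuous and $$0\ \ge\ \Delta v(x,\omega)+f(x,v(x,\omega),\omega)+F^*\qquad\text{on }\mathbb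 R^n$$ both in the sense of distributions and in the viscosity sense. Moreover, almost surely, for all $F\le F^*$, every solution is pinned below $v$: if $T>0$ and $u$ is a classical solution on $\mathbb R^n\times[0,T]$ of $$\partial_t u(x,t)=\Delta u(x,t)+f(x,u(x,t),\omega)+F,\qquad u(x,0)=0,$$ with $u(x,t)\le A e^{a|x|^2}$ on $\mathbb R^n\times[0,T]$ for some constants $A,a$, then $u(x,t)\le v(x,\omega)$ for all $x\in\mathbb R^n$ and $t\in[0,T]$. (Here a classical solution is continuous on $\mathbb R^n\times[0,T]$ and, for $0<t<T$, is differentiable in $t$, is $C^2$ in $x$ and satisfies the equation.) -/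

import Mathlib

open MeasureTheory ProbabilityTheory
open scoped NNReal ENNReal

noncomputable section

namespace QEW

/-- The base space `ℝⁿ` with its Euclidean norm. -/
abbrev Base (n : ℕ) : Type := EuclideanSpace ℝ (Fin n)

/-- The ambient space `ℝⁿ × ℝ` of points `(x, y)`. The Euclidean norm on it is written out
where it is needed; the volume is the `(n+1)`-dimensional Lebesgue measure. -/
abbrev Ambient (n : ℕ) : Type := Base n × ℝ

/-- The obstacle shape condition for `φ ∈ C^∞(ℝⁿ × ℝ)` with radii `r₁ > √n r₀ > 0`. -/
structure IsObstacleShape (n : ℕ) (r₀ r₁ : ℝ) (φ : Ambient n → ℝ) : Prop where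
  smooth : ContDiff ℝ ((⊤ : ℕ∞) : WithTop ℕ∞) φ
  sqrt_mul_pos : 0 < √(n : ℝ) * r₀
  sqrt_mul_lt : √(n : ℝ) * r₀ < r₁
  nonpos : ∀ p, φ p ≤ 0
  eq_zero : ∀ p : Ambient n, r₁ < √(‖p.1‖ ^ 2 + p.2 ^ 2) → φ p = 0
  le_neg_one : ∀ p : Ambient n, (∀ i, |p.1 i| ≤ r₀) → |p.2| ≤ r₀ → φ p ≤ -1

/-- The number of indices `k` for which the random point `P k` lies in `A`. -/
def pointCount {Ω S : Type*} (P : ℕ → Ω → S) (A : Set S) (ω : Ω) : ℕ∞ :=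
  {k : ℕ | P k ω ∈ A}.encard

/-- The random points `P 0, P 1, …` form a Poisson point process on the region `D` whose intensity
measure is `lam` times Lebesgue measure restricted to `D`: all points lie in `D`, the number of
points in a Borel set `A ⊆ D` of finite volume is Poisson distributed with parameter
`lam * volume A`, and the numbers of points in pairwise disjoint Borel sets are independent. -/
structure IsPoissonProcess {Ω : Type*} [MeasurableSpace Ω] (μ : Measure Ω) {n : ℕ}
    (D : Set (Ambient n)) (lam : ℝ≥0) (P : ℕ → Ω → Ambient n) : Prop where
  measurable : ∀ k, Measurable (P k)
  mem : ∀ k, ∀ᵐ ω ∂μ, P k ω ∈ D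
  law : ∀ A : Set (Ambient n), MeasurableSet A → A ⊆ D → volume A ≠ ∞ →
    ∀ m : ℕ, μ {ω | pointCount P A ω = m} = poissonMeasure (lam * (volume A).toNNReal) {m}
  indep : ∀ (m : ℕ) (A : Fin m → Set (Ambient n)), (∀ j, MeasurableSet (A j)) →
    (∀ j, A j ⊆ D) → Pairwise (fun i j => Disjoint (A i) (A j)) →
    iIndepFun (fun j => pointCount P (A j)) μ

/-- The obstacle distribution condition: the obstacle centres `P k = (x_k, y_k)` form a Poisson
process on `ℝⁿ × [r₁, ∞)` with intensity `lam > 0`, and the strengths `s k` are iid strictly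
positive random variables, independent of the centres. -/
structure IsObstacleDistribution {Ω : Type*} [MeasurableSpace Ω] (μ : Measure Ω) {n : ℕ}
    (r₁ : ℝ) (lam : ℝ≥0) (P : ℕ → Ω → Ambient n) (s : ℕ → Ω → ℝ) : Prop where
  intensity_pos : 0 < lam
  poisson : IsPoissonProcess μ {p : Ambient n | r₁ ≤ p.2} lam P
  strength_measurable : ∀ k, Measurable (s k)
  strength_pos : ∀ k, ∀ᵐ ω ∂μ, 0 < s k ω
  strength_indep : iIndepFun s μ
  strength_identDistrib : ∀ k, IdentDistrib (s k) (s 0) μ μ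
  indep_centres : IndepFun (fun ω k => s k ω) (fun ω k => P k ω) μ

/-- The random field
`f(x, y, ω) = ∑ₖ sₖ(ω) φ(x - xₖ(ω), y - yₖ(ω))`, with `P k = (x_k, y_k)`.
Under the two conditions above the sum is almost surely locally finite. -/
def obstacleField {Ω : Type*} {n : ℕ} (φ : Ambient n → ℝ) (P : ℕ → Ω → Ambient n)
    (s : ℕ → Ω → ℝ) (ω : Ω) (x : Base n) (y : ℝ) : ℝ :=
  ∑' k, s k ω * φ ((x, y) - P k ω)

/-- `0 ≥ Δv + f(x, v(x)) + F` on `ℝⁿ` in the sense of distributions. -/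
structure IsDistribSupersolution {n : ℕ} (f : Base n → ℝ → ℝ) (F : ℝ) (v : Base n → ℝ) :
    Prop where
  locallyIntegrable : LocallyIntegrable v
  locallyIntegrable_field : LocallyIntegrable (fun x => f x (v x))
  le_zero : ∀ ψ : Base n → ℝ, ContDiff ℝ ((⊤ : ℕ∞) : WithTop ℕ∞) ψ → HasCompactSupport ψ → (∀ x, 0 ≤ ψ x) →
    (∫ x, v x * Laplacian.laplacian ψ x) + ∫ x, (f x (v x) + F) * ψ x ≤ 0

/-- `0 ≥ Δv + f(x, v(x)) + F` on `ℝⁿ` in the viscosity sense: `v` is lower semicontinuous, and the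
inequality holds for every `C²` function touching `v` from below at a point. -/
structure IsViscositySupersolution {n : ℕ} (f : Base n → ℝ → ℝ) (F : ℝ) (v : Base n → ℝ) :
    Prop where
  lowerSemicontinuous : LowerSemicontinuous v
  le_zero : ∀ (ψ : Base n → ℝ) (x₀ : Base n), ContDiff ℝ 2 ψ →
    IsLocalMin (fun x => v x - ψ x) x₀ → Laplacian.laplacian ψ x₀ + f x₀ (v x₀) + F ≤ 0

/-- `u` is a classical solution on `ℝⁿ × [0, T]` of `∂ₜu = Δu + f(x, u) + F`, `u(x, 0) = 0`. -/
structure IsSolution {n : ℕ} (f : Base n → ℝ → ℝ) (F T : ℝ) (u : Base n → ℝ → ℝ) : Prop where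
  continuousOn : ContinuousOn (fun p : Base n × ℝ => u p.1 p.2) (Set.univ ×ˢ Set.Icc 0 T)
  initial : ∀ x, u x 0 = 0
  contDiff : ∀ t ∈ Set.Ioo 0 T, ContDiff ℝ 2 (fun x => u x t)
  hasDerivAt : ∀ x, ∀ t ∈ Set.Ioo 0 T,
    HasDerivAt (fun τ => u x τ) (Laplacian.laplacian (fun z => u z t) x + f x (u x t) + F) t

/-- At most Gaussian growth `u(x, t) ≤ A exp(a |x|²)` on `ℝⁿ × [0, T]`: the usual class in which
the Cauchy problem for the heat equation satisfies a comparison principle. -/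
def HasGaussianGrowth {n : ℕ} (T : ℝ) (u : Base n → ℝ → ℝ) : Prop :=
  ∃ A a : ℝ, ∀ x, ∀ t ∈ Set.Icc 0 T, u x t ≤ A * Real.exp (a * ‖x‖ ^ 2)

end QEW

end

/-!
# A pinned solution of the quenched Edwards-Wilkinson equation

The supersolution is the lower envelope `v(x) = inf_k (y_k + V(x - x_k))` of copies of one radial
profile, centred at suitably chosen obstacles `(x_k, y_k)` of strength at least `c > 0`.

*Profile* (`exists_profile`). `W(x) = A (a⁻ᵐ - (a + |x|²)⁻ᵐ)` with `m = n/2 - 1/4` is strictly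
superharmonic for `|x| ≥ r₀`, and its positive Laplacian near the centre is dominated by the force
`c` of the obstacle. Between distance `n ℓ` and distance `2 n ℓ` it rises by a multiple of
`ℓ^(1/2 - n)`, which for large `ℓ` exceeds any given multiple of `ℓ⁻ⁿ`.

*Choice of obstacles* (`ae_finite_reachable`, `surfaceIndices`). Cut `ℝⁿ × [r₁, ∞)` into boxes of side
`ℓ` and height `hgt = B ℓ⁻ⁿ`. Whatever `ℓ` is, the box volume is `B`, so for large `B` any `N` given
boxes are all free of obstacles of strength at least `c` with probability at most `θ ^ (2 N)`, `θ`
small; this follows from the Poisson law of the number of points in their union and from thinning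
(`IsObstacleDistribution.measure_weak_le`). Lipschitz percolation then yields a surface of nonempty
boxes whose heights in neighbouring columns differ by at most one: it lies right above the sites
reachable from the bottom by paths that go up only into empty boxes, and a union bound over shortest
paths shows that these sites are almost surely bounded in height above each column.

*Envelope* (`isStrictSupersolution_envelope`). The heights of the chosen obstacles vary by a multiple
of `hgt` over distances of order `ℓ`, less than the rise of the profile. Hence only profiles centred
within `2 n ℓ` of `x` are active at `x`, and there each satisfies the differential inequality
strictly, with margin.

*Consequences*. The whole analysis uses only the discrete inequality
`Δ_h v + f(x, y) + F + η ≤ 0` for small steps `h` and `y ∈ [v(x), v(x) + δ]`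
(`IsStrictSupersolution`), which passes to lower envelopes at once. It gives the viscosity
inequality by comparing second differences at a touching point, and the distributional one by
summation by parts. For the comparison, `f` has no uniform modulus of continuity in `y`, since the
strengths are unbounded; but `f ≤ 0` and the Lipschitz continuity of `v` show that `u` cannot exceed
`v` by more than `δ` within a short time (`IsSolution.le_paraboloid`), and in that range of heights
the margin `η` excludes a positive maximum of `u - v` (`le_of_le_add_range`).
-/

noncomputable section

namespace QEW

/-! ### Second differences and the Laplacian -/

/-- The `i`-th standard unit vector of `ℝⁿ`. -/
abbrev unitVec {n : ℕ} (i : Fin n) : Base n := EuclideanSpace.single i (1 : ℝ)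

/-- The discrete Laplacian with step `h`, without the factor `h⁻²`: the sum of the symmetric second
differences of `w` at `x` along the coordinate directions. -/
def secondDiff {n : ℕ} (h : ℝ) (w : Base n → ℝ) (x : Base n) : ℝ :=
  ∑ i, (w (x + h • unitVec i) + w (x - h • unitVec i) - 2 * w x)

lemma norm_smul_unitVec {n : ℕ} (i : Fin n) (h : ℝ) : ‖h • (unitVec i : Base n)‖ = |h| := by
  simp [norm_smul]

lemma symmDiff_le_of_deriv2_le {g g' g'' : ℝ → ℝ} {h M : ℝ} (hh : 0 ≤ h)
    (hg : ∀ t ∈ Set.Icc (-h) h, HasDerivAt g (g' t) t)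
    (hg' : ∀ t ∈ Set.Icc (-h) h, HasDerivAt g' (g'' t) t)
    (hM : ∀ t ∈ Set.Icc (-h) h, g'' t ≤ M) :
    g h + g (-h) - 2 * g 0 ≤ M * h ^ 2 := by
  -- `g` minus the parabola `M t² / 2` is concave.
  have key : ConcaveOn ℝ (Set.Icc (-h) h) (fun t => g t - M / 2 * t ^ 2) := by
    have h1 : ∀ t ∈ Set.Icc (-h) h,
        HasDerivAt (fun t => g t - M / 2 * t ^ 2) (g' t - M * t) t := by
      intro t ht
      refine ((hg t ht).fun_sub (((hasDerivAt_id' t).fun_pow 2).const_mul (M / 2))).congr_deriv ?_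
      ring
    have h2 : ∀ t ∈ Set.Icc (-h) h, HasDerivAt (fun t => g' t - M * t) (g'' t - M) t := by
      intro t ht
      exact ((hg' t ht).fun_sub ((hasDerivAt_id' t).const_mul M)).congr_deriv (by ring)
    have hd : ∀ t ∈ interior (Set.Icc (-h) h),
        deriv (fun t => g t - M / 2 * t ^ 2) =ᶠ[nhds t] fun t => g' t - M * t := by
      intro t ht
      filter_upwards [isOpen_interior.mem_nhds ht] with s hs
      exact (h1 s (interior_subset hs)).deriv
    refine concaveOn_of_deriv2_nonpos (convex_Icc _ _)
      (fun t ht => (h1 t ht).continuousAt.continuousWithinAt)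
      (fun t ht => (h1 t (interior_subset ht)).differentiableAt.differentiableWithinAt) ?_ ?_
    · intro t ht
      exact ((h2 t (interior_subset ht)).differentiableAt.congr_of_eventuallyEq
        (hd t ht)).differentiableWithinAt
    · intro t ht
      have : deriv^[2] (fun t => g t - M / 2 * t ^ 2) t = g'' t - M := by
        simp only [Function.iterate_succ, Function.iterate_zero, Function.comp_def, id]
        rw [(hd t ht).deriv_eq, (h2 t (interior_subset ht)).deriv]
      rw [this]
      linarith [hM t (interior_subset ht)]
  have hmid : (1 / 2 : ℝ) + 1 / 2 = 1 := by norm_num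
  have := key.2 (⟨by linarith, le_rfl⟩ : h ∈ Set.Icc (-h) h)
    (⟨le_rfl, by linarith⟩ : -h ∈ Set.Icc (-h) h) (by norm_num) (by norm_num) hmid
  simp only [smul_eq_mul] at this
  have e : (1 / 2 * h + 1 / 2 * -h : ℝ) = 0 := by ring
  rw [e] at this
  nlinarith

/-- The second derivative of `ψ` along the `i`-th coordinate direction. -/
def coordDeriv2 {n : ℕ} (ψ : Base n → ℝ) (i : Fin n) (x : Base n) : ℝ :=
  fderiv ℝ (fderiv ℝ ψ) x (unitVec i) (unitVec i)

lemma laplacian_eq_sum_coordDeriv2 {n : ℕ} (ψ : Base n → ℝ) (x : Base n) :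
    Laplacian.laplacian ψ x = ∑ i, coordDeriv2 ψ i x := by
  have := congrFun (InnerProductSpace.laplacian_eq_iteratedFDeriv_orthonormalBasis ψ
    (EuclideanSpace.basisFun (Fin n) ℝ)) x
  rw [this]
  refine Finset.sum_congr rfl fun i _ => ?_
  simp [iteratedFDeriv_two_apply, coordDeriv2, unitVec]

lemma hasDerivAt_line {n : ℕ} {ψ : Base n → ℝ} (hψ : ContDiff ℝ 2 ψ) (i : Fin n) (x : Base n)
    (t : ℝ) : HasDerivAt (fun t : ℝ => ψ (x + t • unitVec i))
      (fderiv ℝ ψ (x + t • unitVec i) (unitVec i)) t := by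
  have h1 : HasDerivAt (fun t : ℝ => x + t • (unitVec i : Base n)) (unitVec i) t := by
    simpa using ((hasDerivAt_id t).smul_const (unitVec i : Base n)).const_add x
  exact ((hψ.differentiable (by norm_num)) _).hasFDerivAt.comp_hasDerivAt t h1

lemma hasDerivAt_line_fderiv {n : ℕ} {ψ : Base n → ℝ} (hψ : ContDiff ℝ 2 ψ) (i : Fin n)
    (x : Base n) (t : ℝ) :
    HasDerivAt (fun t : ℝ => fderiv ℝ ψ (x + t • unitVec i) (unitVec i))
      (coordDeriv2 ψ i (x + t • unitVec i)) t := by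
  have h1 : HasDerivAt (fun t : ℝ => x + t • (unitVec i : Base n)) (unitVec i) t := by
    simpa using ((hasDerivAt_id t).smul_const (unitVec i : Base n)).const_add x
  have h2 : ContDiff ℝ 1 (fderiv ℝ ψ) := hψ.fderiv_right (by norm_num)
  have h3 := ((h2.differentiable (by norm_num)) (x + t • unitVec i)).hasFDerivAt.comp_hasDerivAt t h1
  have := h3.clm_apply (hasDerivAt_const t (unitVec i : Base n))
  simpa [coordDeriv2] using this

lemma continuous_coordDeriv2 {n : ℕ} {ψ : Base n → ℝ} (hψ : ContDiff ℝ 2 ψ) (i : Fin n) :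
    Continuous (coordDeriv2 ψ i) := by
  have h2 : ContDiff ℝ 1 (fderiv ℝ ψ) := hψ.fderiv_right (by norm_num)
  have h3 : Continuous (fderiv ℝ (fderiv ℝ ψ)) := h2.continuous_fderiv (by norm_num)
  exact (h3.clm_apply continuous_const).clm_apply continuous_const

lemma continuous_laplacian {n : ℕ} {ψ : Base n → ℝ} (hψ : ContDiff ℝ 2 ψ) :
    Continuous (Laplacian.laplacian ψ : Base n → ℝ) := by
  have : (Laplacian.laplacian ψ : Base n → ℝ) = fun x => ∑ i, coordDeriv2 ψ i x :=
    funext (laplacian_eq_sum_coordDeriv2 ψ)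
  rw [this]
  exact continuous_finsetSum _ fun i _ => continuous_coordDeriv2 hψ i

/-- The rescaled discrete Laplacian of a `C²` function converges to its Laplacian, uniformly on
compact sets. -/
lemma exists_abs_secondDiff_sub_laplacian_le {n : ℕ} {ψ : Base n → ℝ} (hψ : ContDiff ℝ 2 ψ)
    {K : Set (Base n)} (hK : IsCompact K) {ε : ℝ} (hε : 0 < ε) :
    ∃ h₀ : ℝ, 0 < h₀ ∧ ∀ h, 0 < h → h < h₀ → ∀ x ∈ K,
      |secondDiff h ψ x - Laplacian.laplacian ψ x * h ^ 2| ≤ ε * h ^ 2 := by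
  obtain ⟨δ, hδ, hδ'⟩ : ∃ δ : ℝ, 0 < δ ∧ ∀ i : Fin n, ∀ x ∈ K, ∀ y, dist x y < δ →
      |coordDeriv2 ψ i y - coordDeriv2 ψ i x| ≤ ε / (n + 1) := by
    have : ∀ i : Fin n, ∃ δ : ℝ, 0 < δ ∧ ∀ x ∈ K, ∀ y, dist x y < δ →
        |coordDeriv2 ψ i y - coordDeriv2 ψ i x| ≤ ε / (n + 1) := by
      intro i
      have hK' : IsCompact (Metric.cthickening 1 K) := hK.cthickening
      have := hK'.uniformContinuousOn_of_continuous (continuous_coordDeriv2 hψ i).continuousOn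
      rw [Metric.uniformContinuousOn_iff] at this
      obtain ⟨δ, hδ, H⟩ := this (ε / (n + 1)) (by positivity)
      refine ⟨min δ 1, by positivity, fun x hx y hxy => ?_⟩
      have hy : y ∈ Metric.cthickening 1 K := by
        refine Metric.mem_cthickening_of_dist_le y x 1 K hx ?_
        rw [dist_comm]; exact (hxy.trans_le (min_le_right _ _)).le
      have := H x (Metric.self_subset_cthickening _ hx) y hy (hxy.trans_le (min_le_left _ _))
      rw [dist_comm, Real.dist_eq] at this
      exact this.le
    choose δ hδ H using this
    by_cases hn : Nonempty (Fin n)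
    · refine ⟨Finset.univ.inf' Finset.univ_nonempty δ, ?_, fun i x hx y hxy => ?_⟩
      · simpa using hδ
      · exact H i x hx y (hxy.trans_le (Finset.inf'_le _ (Finset.mem_univ i)))
    · exact ⟨1, one_pos, fun i => (hn ⟨i⟩).elim⟩
  refine ⟨δ, hδ, fun h hh hhδ x hx => ?_⟩
  have hmem : ∀ i : Fin n, ∀ t ∈ Set.Icc (-h) h,
      |coordDeriv2 ψ i (x + t • unitVec i) - coordDeriv2 ψ i x| ≤ ε / (n + 1) := by
    intro i t ht
    refine hδ' i x hx _ ?_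
    rw [dist_eq_norm, sub_add_cancel_left, norm_neg, norm_smul_unitVec]
    exact (abs_le.2 ht).trans_lt hhδ
  have hi : ∀ i : Fin n, |ψ (x + h • unitVec i) + ψ (x - h • unitVec i) - 2 * ψ x
      - coordDeriv2 ψ i x * h ^ 2| ≤ ε / (n + 1) * h ^ 2 := by
    intro i
    have h1 := symmDiff_le_of_deriv2_le (M := coordDeriv2 ψ i x + ε / (n + 1)) hh.le
      (fun t _ => hasDerivAt_line hψ i x t) (fun t _ => hasDerivAt_line_fderiv hψ i x t)
      (fun t ht => by have := (abs_le.1 (hmem i t ht)).2; linarith)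
    have h2 := symmDiff_le_of_deriv2_le (M := -coordDeriv2 ψ i x + ε / (n + 1)) hh.le
      (fun t _ => (hasDerivAt_line hψ i x t).neg) (fun t _ => (hasDerivAt_line_fderiv hψ i x t).neg)
      (fun t ht => by have := (abs_le.1 (hmem i t ht)).1; linarith)
    simp only [zero_smul, add_zero, neg_smul, ← sub_eq_add_neg, Pi.neg_apply] at h1 h2
    rw [abs_le]
    constructor <;> nlinarith
  rw [laplacian_eq_sum_coordDeriv2, secondDiff, Finset.sum_mul, ← Finset.sum_sub_distrib]
  refine (Finset.abs_sum_le_sum_abs _ _).trans ((Finset.sum_le_sum fun i _ => hi i).trans ?_)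
  rw [Finset.sum_const, Finset.card_univ, Fintype.card_fin, nsmul_eq_mul, ← mul_assoc]
  gcongr
  rw [mul_div_assoc', div_le_iff₀ (by positivity)]
  nlinarith

/-- The Laplacian of a radial function, written through the squared distance to the centre. -/
lemma laplacian_radial {n : ℕ} {G G' G'' : ℝ → ℝ} (c : Base n)
    (hG : ∀ s, 0 ≤ s → HasDerivAt G (G' s) s) (hG' : ∀ s, 0 ≤ s → HasDerivAt G' (G'' s) s)
    (hψ : ContDiff ℝ 2 (fun x : Base n => G (‖x - c‖ ^ 2))) (x : Base n) :
    Laplacian.laplacian (fun x : Base n => G (‖x - c‖ ^ 2)) x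
      = 2 * n * G' (‖x - c‖ ^ 2) + 4 * ‖x - c‖ ^ 2 * G'' (‖x - c‖ ^ 2) := by
  have key : ∀ i : Fin n, coordDeriv2 (fun x : Base n => G (‖x - c‖ ^ 2)) i x
      = 2 * G' (‖x - c‖ ^ 2) + 4 * (x - c) i ^ 2 * G'' (‖x - c‖ ^ 2) := by
    intro i
    have hline : ∀ t : ℝ, ‖x + t • unitVec i - c‖ ^ 2
        = ‖x - c‖ ^ 2 + 2 * t * (x - c) i + t ^ 2 := by
      intro t
      have : x + t • unitVec i - c = (x - c) + t • (unitVec i : Base n) := by abel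
      rw [this, norm_add_sq_real, norm_smul_unitVec, inner_smul_right, sq_abs]
      simp [unitVec, EuclideanSpace.inner_single_right]
      ring
    have hs : ∀ t : ℝ, HasDerivAt (fun t : ℝ => ‖x + t • unitVec i - c‖ ^ 2)
        (2 * (x - c) i + 2 * t) t := by
      intro t
      simp only [hline]
      exact (((((hasDerivAt_id' t).const_mul 2).mul_const ((x - c) i)).const_add
        (‖x - c‖ ^ 2)).fun_add ((hasDerivAt_id' t).fun_pow 2)).congr_deriv (by ring)
    have hfirst : ∀ t : ℝ, fderiv ℝ (fun x : Base n => G (‖x - c‖ ^ 2)) (x + t • unitVec i)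
        (unitVec i) = G' (‖x + t • unitVec i - c‖ ^ 2) * (2 * (x - c) i + 2 * t) := by
      intro t
      exact (hasDerivAt_line hψ i x t).unique
        ((hG _ (sq_nonneg ‖x + t • unitVec i - c‖)).comp t (hs t))
    have h2 := hasDerivAt_line_fderiv hψ i x 0
    simp only [hfirst] at h2
    have h3 := ((hG' _ (sq_nonneg ‖x + (0 : ℝ) • unitVec i - c‖)).comp (0 : ℝ) (hs 0)).mul
      (((hasDerivAt_id (0 : ℝ)).const_mul 2).const_add (2 * (x - c) i))
    have h4 := h2.unique h3
    simp only [zero_smul, add_zero, mul_zero, Function.comp, id] at h4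
    rw [h4]
    ring
  rw [laplacian_eq_sum_coordDeriv2, Finset.sum_congr rfl fun i _ => key i, Finset.sum_add_distrib,
    ← Finset.sum_mul, ← Finset.sum_mul, ← Finset.mul_sum, EuclideanSpace.norm_sq_eq]
  simp only [Finset.sum_const, Finset.card_univ, Fintype.card_fin, nsmul_eq_mul,
    Real.norm_eq_abs, sq_abs]
  ring

lemma laplacian_add_const_mul {n : ℕ} {ψ χ : Base n → ℝ} (hψ : ContDiff ℝ 2 ψ)
    (hχ : ContDiff ℝ 2 χ) (a b : ℝ) (x : Base n) :
    Laplacian.laplacian (fun y => ψ y + (a * χ y + b)) x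
      = Laplacian.laplacian ψ x + a * Laplacian.laplacian χ x := by
  have h1 : ContDiff ℝ 2 (fun y => a * χ y) := contDiff_const.mul hχ
  have e1 : Laplacian.laplacian (fun y => ψ y + (a * χ y + b)) x
      = Laplacian.laplacian ψ x + Laplacian.laplacian (fun y => a * χ y + b) x :=
    hψ.contDiffAt.laplacian_add (h1.add contDiff_const).contDiffAt
  have e2 : Laplacian.laplacian (fun y => a * χ y + b) x
      = Laplacian.laplacian (fun y => a * χ y) x + Laplacian.laplacian (fun _ : Base n => b) x :=
    h1.contDiffAt.laplacian_add contDiff_const.contDiffAt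
  have e3 : Laplacian.laplacian (fun y => a * χ y) x = a * Laplacian.laplacian χ x :=
    InnerProductSpace.laplacian_smul a hχ.contDiffAt
  rw [e1, e2, e3, InnerProductSpace.laplacian_const]
  simp

/-! ### Strict supersolutions in the sense of second differences -/

/-- A strong form of `0 > Δv + f(x, v) + F` that asks for no regularity beyond Lipschitz continuity:
the inequality holds for all difference quotients of step less than `h₀`, with a margin `η`, and
it persists when the argument `v x` of `f` is raised by up to `δ`. -/
structure IsStrictSupersolution {n : ℕ} (f : Base n → ℝ → ℝ) (F h₀ δ η : ℝ) (v : Base n → ℝ) :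
    Prop where
  nonneg : ∀ x, 0 ≤ v x
  lipschitz : ∃ L : ℝ≥0, LipschitzWith L v
  step_pos : 0 < h₀
  range_pos : 0 < δ
  margin_pos : 0 < η
  secondDiff_le : ∀ x h y, 0 < h → h < h₀ → v x ≤ y → y ≤ v x + δ →
    secondDiff h v x + (f x y + F + η) * h ^ 2 ≤ 0

namespace IsStrictSupersolution

variable {n : ℕ} {f : Base n → ℝ → ℝ} {F h₀ δ η : ℝ} {v : Base n → ℝ}

lemma continuous (hv : IsStrictSupersolution f F h₀ δ η v) : Continuous v :=
  hv.lipschitz.choose_spec.continuous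

lemma laplacian_le_of_isLocalMin (hv : IsStrictSupersolution f F h₀ δ η v) {ψ : Base n → ℝ}
    {x₀ : Base n} {y : ℝ} (hψ : ContDiff ℝ 2 ψ) (hmin : IsLocalMin (fun x => v x - ψ x) x₀)
    (hy : v x₀ ≤ y) (hy' : y ≤ v x₀ + δ) :
    Laplacian.laplacian ψ x₀ + f x₀ y + F + η ≤ 0 := by
  refine le_of_forall_pos_le_add fun ε hε => ?_
  obtain ⟨h₁, hh₁, H₁⟩ := exists_abs_secondDiff_sub_laplacian_le hψ
    (isCompact_singleton (x := x₀)) hε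
  obtain ⟨r, hr, H₂⟩ := Metric.eventually_nhds_iff.1 hmin
  set h := min (min h₀ h₁) r / 2 with hdef
  have hpos : 0 < min (min h₀ h₁) r := lt_min (lt_min hv.step_pos hh₁) hr
  have hh : 0 < h := by positivity
  have hlt : h < min (min h₀ h₁) r := half_lt_self hpos
  have hlt₀ : h < h₀ := hlt.trans_le ((min_le_left _ _).trans (min_le_left _ _))
  have hlt₁ : h < h₁ := hlt.trans_le ((min_le_left _ _).trans (min_le_right _ _))
  have hltr : h < r := hlt.trans_le (min_le_right _ _)
  have hle : secondDiff h ψ x₀ ≤ secondDiff h v x₀ := by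
    refine Finset.sum_le_sum fun i _ => ?_
    have a1 := @H₂ (x₀ + h • unitVec i) (by
      rw [dist_self_add_left, norm_smul_unitVec, abs_of_pos hh]; exact hltr)
    have a2 := @H₂ (x₀ - h • unitVec i) (by
      rw [dist_self_sub_left, norm_smul_unitVec, abs_of_pos hh]; exact hltr)
    linarith
  have h1 := (abs_le.1 (H₁ h hh hlt₁ x₀ rfl)).1
  have h2 := hv.secondDiff_le x₀ h y hh hlt₀ hy hy'
  have h3 : 0 < h ^ 2 := by positivity
  by_contra hcon
  push Not at hcon
  nlinarith

lemma isViscositySupersolution (hv : IsStrictSupersolution f F h₀ δ η v) :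
    IsViscositySupersolution f F v where
  lowerSemicontinuous := hv.continuous.lowerSemicontinuous
  le_zero ψ x₀ hψ hmin := by
    have := hv.laplacian_le_of_isLocalMin hψ hmin le_rfl (by linarith [hv.range_pos])
    linarith [hv.margin_pos]

end IsStrictSupersolution

lemma integral_mul_secondDiff {n : ℕ} {v ψ : Base n → ℝ} (hv : Continuous v) (hψ : Continuous ψ)
    (hc : HasCompactSupport ψ) (h : ℝ) :
    ∫ x, v x * secondDiff h ψ x = ∫ x, secondDiff h v x * ψ x := by
  have hsupp : ∀ c : Base n, HasCompactSupport fun x => ψ (x + c) := fun c =>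
    hc.comp_homeomorph (Homeomorph.addRight c)
  have hi : ∀ c : Base n, Integrable fun x => v x * ψ (x + c) := fun c =>
    (hv.mul (hψ.comp (continuous_id.add continuous_const))).integrable_of_hasCompactSupport
      (hsupp c).mul_left
  have hi' : ∀ c : Base n, Integrable fun x => v (x + c) * ψ x := fun c =>
    ((hv.comp (continuous_id.add continuous_const)).mul hψ).integrable_of_hasCompactSupport
      hc.mul_left
  have hshift : ∀ c : Base n, ∫ x, v x * ψ (x + c) = ∫ x, v (x - c) * ψ x := fun c => by
    rw [← integral_sub_right_eq_self _ c]
    simp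
  have h0 : Integrable fun x => v x * ψ x := by simpa using hi 0
  have e1 : ∀ x, v x * secondDiff h ψ x = ∑ i, (v x * ψ (x + h • unitVec i)
      + v x * ψ (x + -(h • unitVec i)) - 2 * (v x * ψ x)) := fun x => by
    rw [secondDiff, Finset.mul_sum]
    refine Finset.sum_congr rfl fun i _ => ?_
    rw [← sub_eq_add_neg]
    ring
  have e2 : ∀ x, secondDiff h v x * ψ x = ∑ i, (v (x + h • unitVec i) * ψ x
      + v (x + -(h • unitVec i)) * ψ x - 2 * (v x * ψ x)) := fun x => by
    rw [secondDiff, Finset.sum_mul]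
    refine Finset.sum_congr rfl fun i _ => ?_
    rw [← sub_eq_add_neg]
    ring
  simp_rw [e1, e2]
  have hA : ∀ i, Integrable fun x => v x * ψ (x + h • unitVec i)
      + v x * ψ (x + -(h • unitVec i)) := fun i => (hi _).add (hi _)
  have hA' : ∀ i, Integrable fun x => v (x + h • unitVec i) * ψ x
      + v (x + -(h • unitVec i)) * ψ x := fun i => (hi' _).add (hi' _)
  have h2 := h0.const_mul 2
  rw [integral_finsetSum _ fun i _ => (hA i).sub' h2, integral_finsetSum _ fun i _ => (hA' i).sub' h2]
  refine Finset.sum_congr rfl fun i _ => ?_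
  rw [integral_sub (hA i) h2, integral_add (hi _) (hi _), integral_sub (hA' i) h2,
    integral_add (hi' _) (hi' _), hshift, hshift]
  simp only [sub_neg_eq_add, ← sub_eq_add_neg]
  ring

lemma continuous_secondDiff {n : ℕ} {w : Base n → ℝ} (hw : Continuous w) (h : ℝ) :
    Continuous (secondDiff h w) := by
  unfold secondDiff
  fun_prop

lemma IsStrictSupersolution.isDistribSupersolution {n : ℕ} {f : Base n → ℝ → ℝ}
    {F h₀ δ η : ℝ} {v : Base n → ℝ} (hv : IsStrictSupersolution f F h₀ δ η v)
    (hf : Continuous fun x => f x (v x)) : IsDistribSupersolution f F v where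
  locallyIntegrable := hv.continuous.locallyIntegrable
  locallyIntegrable_field := hf.locallyIntegrable
  le_zero ψ hψ hc hpos := by
    have hψ2 : ContDiff ℝ 2 ψ := contDiff_infty.1 hψ 2
    have hψc := hψ.continuous
    have hvc := hv.continuous
    set K := Metric.cthickening 1 (tsupport ψ) with hK
    have hKc : IsCompact K := hc.isCompact.cthickening
    have hout : ∀ x ∉ K, ∀ c : Base n, ‖c‖ ≤ 1 → ψ (x + c) = 0 := by
      intro x hx c hc1
      refine image_eq_zero_of_notMem_tsupport fun hmem => hx ?_
      refine Metric.mem_cthickening_of_dist_le x _ 1 _ hmem ?_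
      rwa [dist_self_add_right]
    have hΔout : ∀ x ∉ K, Laplacian.laplacian ψ x = 0 := by
      intro x hx
      have hx' : x ∉ tsupport ψ := fun hmem => hx (Metric.self_subset_cthickening _ hmem)
      refine (InnerProductSpace.laplacian_congr_nhds
        (notMem_tsupport_iff_eventuallyEq.1 hx')).eq_of_nhds.trans ?_
      exact congrFun (InnerProductSpace.laplacian_const (c := (0 : ℝ))) x
    have hΔc := continuous_laplacian hψ2
    have hΔsupp : HasCompactSupport (Laplacian.laplacian ψ : Base n → ℝ) :=
      HasCompactSupport.intro hKc hΔout
    have hIΔ : Integrable fun x => v x * Laplacian.laplacian ψ x :=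
      (hvc.mul hΔc).integrable_of_hasCompactSupport hΔsupp.mul_left
    have hIf : Integrable fun x => (f x (v x) + F) * ψ x :=
      ((hf.add continuous_const).mul hψc).integrable_of_hasCompactSupport hc.mul_left
    set C := ∫ x in K, |v x| with hC
    have hC0 : 0 ≤ C := integral_nonneg fun x => abs_nonneg _
    have hvK : IntegrableOn (fun x => |v x|) K := hvc.abs.continuousOn.integrableOn_compact hKc
    refine le_of_forall_pos_le_add fun ε hε => ?_
    rw [zero_add]
    obtain ⟨h₁, hh₁, H₁⟩ := exists_abs_secondDiff_sub_laplacian_le hψ2 hKc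
      (ε := ε / (C + 1)) (by positivity)
    obtain ⟨h, hh, hh'⟩ := exists_between (lt_min (lt_min hv.step_pos hh₁) one_pos)
    simp only [lt_min_iff] at hh'
    obtain ⟨⟨hlt₀, hlt₁⟩, hlt2⟩ := hh'
    have hh2 : 0 < h ^ 2 := by positivity
    have hSout : ∀ x ∉ K, secondDiff h ψ x = 0 := by
      intro x hx
      refine Finset.sum_eq_zero fun i _ => ?_
      have hn : ‖h • (unitVec i : Base n)‖ ≤ 1 := by
        rw [norm_smul_unitVec, abs_of_pos hh]; exact hlt2.le
      have a1 := hout x hx _ hn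
      have a2 := hout x hx (-(h • unitVec i)) (by rwa [norm_neg])
      have a3 := hout x hx 0 (by simp)
      rw [← sub_eq_add_neg] at a2
      rw [add_zero] at a3
      rw [a1, a2, a3]; ring
    have hIS : Integrable fun x => v x * secondDiff h ψ x :=
      (hvc.mul (continuous_secondDiff hψc h)).integrable_of_hasCompactSupport
        (HasCompactSupport.intro hKc hSout).mul_left
    have hISv : Integrable fun x => secondDiff h v x * ψ x :=
      ((continuous_secondDiff hvc h).mul hψc).integrable_of_hasCompactSupport hc.mul_left
    have step1 : h ^ 2 * ∫ x, v x * Laplacian.laplacian ψ x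
        ≤ (∫ x, v x * secondDiff h ψ x) + ε * h ^ 2 := by
      have hpt : ∀ x, h ^ 2 * (v x * Laplacian.laplacian ψ x)
          ≤ v x * secondDiff h ψ x + K.indicator (fun x => ε / (C + 1) * h ^ 2 * |v x|) x := by
        intro x
        by_cases hx : x ∈ K
        · rw [Set.indicator_of_mem hx]
          have h1 := H₁ h hh hlt₁ x hx
          have h2 : |v x * (Laplacian.laplacian ψ x * h ^ 2 - secondDiff h ψ x)|
              ≤ |v x| * (ε / (C + 1) * h ^ 2) := by
            rw [abs_mul, abs_sub_comm]
            gcongr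
          have h3 := (abs_le.1 h2).2
          nlinarith
        · rw [Set.indicator_of_notMem hx, hΔout x hx, hSout x hx]
          simp
      have hIind : Integrable (K.indicator (fun x => ε / (C + 1) * h ^ 2 * |v x|)) :=
        (integrable_indicator_iff hKc.measurableSet).2 (hvK.const_mul _)
      rw [← integral_const_mul]
      refine (integral_mono (hIΔ.const_mul _) (hIS.add hIind) hpt).trans ?_
      rw [integral_add' hIS hIind, integral_indicator hKc.measurableSet, integral_const_mul, ← hC]
      have : ε / (C + 1) * C ≤ ε := by
        rw [div_mul_eq_mul_div, div_le_iff₀ (by positivity)]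
        nlinarith
      nlinarith
    have step2 : ∫ x, secondDiff h v x * ψ x ≤ -(h ^ 2 * ∫ x, (f x (v x) + F) * ψ x) := by
      rw [← integral_const_mul, ← integral_neg]
      refine integral_mono hISv (hIf.const_mul _).neg fun x => ?_
      have h1 := hv.secondDiff_le x h (v x) hh hlt₀ le_rfl (by linarith [hv.range_pos])
      have h2 := hpos x
      have h3 : secondDiff h v x ≤ -((f x (v x) + F) * h ^ 2) := by nlinarith [hv.margin_pos]
      have := mul_le_mul_of_nonneg_right h3 h2
      simp only
      linarith
    rw [integral_mul_secondDiff hvc hψc hc] at step1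
    have : h ^ 2 * ((∫ x, v x * Laplacian.laplacian ψ x) + ∫ x, (f x (v x) + F) * ψ x)
        ≤ h ^ 2 * ε := by linarith
    exact le_of_mul_le_mul_left this hh2

/-! ### Comparison with classical solutions -/

lemma laplacian_nonpos_of_forall_le {n : ℕ} {ψ : Base n → ℝ} {x₀ : Base n} (hψ : ContDiff ℝ 2 ψ)
    (hmax : ∀ x, ψ x ≤ ψ x₀) : Laplacian.laplacian ψ x₀ ≤ 0 := by
  refine le_of_forall_pos_le_add fun ε hε => ?_
  obtain ⟨h₁, hh₁, H₁⟩ := exists_abs_secondDiff_sub_laplacian_le hψ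
    (isCompact_singleton (x := x₀)) hε
  obtain ⟨h, hh, hlt⟩ := exists_between hh₁
  have hle : secondDiff h ψ x₀ ≤ 0 := by
    refine Finset.sum_nonpos fun i _ => ?_
    linarith [hmax (x₀ + h • unitVec i), hmax (x₀ - h • unitVec i)]
  have h1 := (abs_le.1 (H₁ h hh hlt x₀ rfl)).1
  have h3 : 0 < h ^ 2 := by positivity
  by_contra hcon
  push Not at hcon
  nlinarith

lemma deriv_nonneg_of_left_max {g : ℝ → ℝ} {d t₀ t : ℝ} (hg : HasDerivAt g d t) (ht : t₀ < t)
    (hmax : ∀ s ∈ Set.Icc t₀ t, g s ≤ g t) : 0 ≤ d := by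
  have h1 := (hasDerivWithinAt_iff_tendsto_slope' (Set.notMem_Iio.2 le_rfl)).1
    (hg.hasDerivWithinAt (s := Set.Iio t))
  refine ge_of_tendsto h1 ?_
  have : ∀ᶠ s in nhdsWithin t (Set.Iio t), t₀ < s :=
    nhdsWithin_le_nhds (lt_mem_nhds ht)
  filter_upwards [this, self_mem_nhdsWithin] with s hs hs'
  rw [slope_def_field]
  exact div_nonneg_of_nonpos (by linarith [hmax s ⟨hs.le, le_of_lt hs'⟩])
    (by linarith [Set.mem_Iio.1 hs'])

/-- A function on a time slab that is nonpositive initially and far out, but positive somewhere,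
attains its positive maximum at a point that is not initial. -/
lemma exists_max_of_pos {n : ℕ} {Φ : Base n → ℝ → ℝ} {t₀ t₁ R : ℝ}
    (hΦ : ContinuousOn (fun p : Base n × ℝ => Φ p.1 p.2) (Set.univ ×ˢ Set.Icc t₀ t₁))
    (hinit : ∀ x, Φ x t₀ ≤ 0) (hfar : ∀ x, R < ‖x‖ → ∀ t ∈ Set.Icc t₀ t₁, Φ x t ≤ 0)
    {x₁ : Base n} {s₁ : ℝ} (hs₁ : s₁ ∈ Set.Icc t₀ t₁) (hpos : 0 < Φ x₁ s₁) :
    ∃ x t, t₀ < t ∧ t ≤ t₁ ∧ 0 < Φ x t ∧ (∀ y, Φ y t ≤ Φ x t) ∧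
      ∀ s ∈ Set.Icc t₀ t, Φ x s ≤ Φ x t := by
  have hK : IsCompact (Metric.closedBall (0 : Base n) R ×ˢ Set.Icc t₀ t₁) :=
    (isCompact_closedBall 0 R).prod isCompact_Icc
  have hx₁ : x₁ ∈ Metric.closedBall (0 : Base n) R := by
    rw [mem_closedBall_zero_iff]
    by_contra h
    linarith [hfar x₁ (not_le.1 h) s₁ hs₁]
  obtain ⟨⟨x, t⟩, ⟨hx, ht⟩, hmax⟩ := hK.exists_isMaxOn ⟨(x₁, s₁), hx₁, hs₁⟩
    (hΦ.mono (Set.prod_mono (Set.subset_univ _) le_rfl))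
  have hΦpos : 0 < Φ x t := hpos.trans_le (hmax (⟨hx₁, hs₁⟩ : (x₁, s₁) ∈ _ ×ˢ _))
  have hall : ∀ y, ∀ s ∈ Set.Icc t₀ t₁, Φ y s ≤ Φ x t := by
    intro y s hs
    by_cases hy : ‖y‖ ≤ R
    · exact hmax (⟨mem_closedBall_zero_iff.2 hy, hs⟩ : (y, s) ∈ _ ×ˢ _)
    · exact (hfar y (not_le.1 hy) s hs).trans hΦpos.le
  refine ⟨x, t, lt_of_le_of_ne ht.1 ?_, ht.2, hΦpos, fun y => hall y t ht,
    fun s hs => hall x s ⟨hs.1, hs.2.trans ht.2⟩⟩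
  rintro rfl
  linarith [hinit x]

lemma contDiff_norm_sub_sq {n : ℕ} (c : Base n) : ContDiff ℝ 2 fun x : Base n => ‖x - c‖ ^ 2 :=
  (contDiff_id.sub contDiff_const).norm_sq ℝ

lemma laplacian_norm_sub_sq {n : ℕ} (c x : Base n) :
    Laplacian.laplacian (fun x : Base n => ‖x - c‖ ^ 2) x = 2 * n := by
  have := laplacian_radial (G := id) (G' := fun _ => 1) (G'' := fun _ => 0) c
    (fun s _ => hasDerivAt_id s) (fun s _ => hasDerivAt_const s 1) (contDiff_norm_sub_sq c) x
  simpa using this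

lemma contDiff_exp_norm_sq {n : ℕ} (β γ : ℝ) :
    ContDiff ℝ 2 fun x : Base n => Real.exp (β * ‖x - 0‖ ^ 2 + γ) :=
  ((contDiff_const.mul (contDiff_norm_sub_sq 0)).add contDiff_const).exp

lemma laplacian_exp_norm_sq {n : ℕ} (β γ : ℝ) (x : Base n) :
    Laplacian.laplacian (fun x : Base n => Real.exp (β * ‖x - 0‖ ^ 2 + γ)) x
      = (2 * n * β + 4 * β ^ 2 * ‖x‖ ^ 2) * Real.exp (β * ‖x‖ ^ 2 + γ) := by
  have hlin : ∀ s : ℝ, HasDerivAt (fun s : ℝ => β * s + γ) β s := fun s =>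
    (((hasDerivAt_id' s).const_mul β).add_const γ).congr_deriv (by ring)
  have hG : ∀ s : ℝ, HasDerivAt (fun s => Real.exp (β * s + γ)) (β * Real.exp (β * s + γ)) s :=
    fun s => (hlin s).exp.congr_deriv (by ring)
  have := laplacian_radial (G := fun s => Real.exp (β * s + γ)) 0 (fun s _ => hG s)
    (fun s _ => ((hG s).const_mul β)) (contDiff_exp_norm_sq β γ) x
  rw [this, sub_zero]
  ring

/-- Comparison of a solution with a caloric paraboloid on a short time interval. The penalty
`ε exp(b (1 + 16 b (t - t₀)) |x|² + (4 n b + 1)(t - t₀))` is a strict supersolution of the heat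
equation as long as `16 b (t - t₀) ≤ 1`, and it outgrows the solution because `a < b`. -/
lemma IsSolution.le_paraboloid {n : ℕ} {f : Base n → ℝ → ℝ} {F T : ℝ} {u : Base n → ℝ → ℝ}
    (hu : IsSolution f F T u) (hf : ∀ x y, f x y ≤ 0) {A a : ℝ} (hA : 0 ≤ A) (ha : 0 ≤ a)
    (hgrowth : ∀ x, ∀ t ∈ Set.Icc 0 T, u x t ≤ A * Real.exp (a * ‖x‖ ^ 2)) {t₀ t₁ : ℝ}
    (ht₀ : 0 ≤ t₀) (ht₁ : t₁ < T) (hshort : 16 * (a + 1) * (t₁ - t₀) ≤ 1)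
    {c₀ C G : ℝ} (hc₀ : 0 ≤ c₀) (hC : 0 ≤ C) (hG : 0 ≤ G) (hFG : F ≤ G) (x₀ : Base n)
    (hinit : ∀ x, u x t₀ ≤ c₀ + C * ‖x - x₀‖ ^ 2) :
    ∀ x, ∀ t ∈ Set.Icc t₀ t₁,
      u x t ≤ c₀ + C * ‖x - x₀‖ ^ 2 + (2 * n * C + G) * (t - t₀) := by
  intro x t ht
  set b := a + 1 with hb
  have hb0 : 0 < b := by linarith
  set H : Base n → ℝ → ℝ := fun x t =>
    Real.exp (b * (1 + 16 * b * (t - t₀)) * ‖x - 0‖ ^ 2 + (4 * n * b + 1) * (t - t₀)) with hH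
  have hHpos : ∀ x t, 0 < H x t := fun x t => Real.exp_pos _
  have main : ∀ ε > 0, u x t - (c₀ + C * ‖x - x₀‖ ^ 2 + (2 * n * C + G) * (t - t₀))
      - ε * H x t ≤ 0 := by
    intro ε hε
    by_contra hcon
    push Not at hcon
    have hsub : Set.univ ×ˢ Set.Icc t₀ t₁ ⊆ (Set.univ : Set (Base n)) ×ˢ Set.Icc 0 T :=
      Set.prod_mono le_rfl (Set.Icc_subset_Icc ht₀ ht₁.le)
    obtain ⟨y, s, hs₀, hs₁, -, hmaxx, hmaxt⟩ := exists_max_of_pos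
      (Φ := fun x t => u x t - (c₀ + C * ‖x - x₀‖ ^ 2 + (2 * n * C + G) * (t - t₀)) - ε * H x t)
      (R := A / ε + 1) (t₀ := t₀) (t₁ := t₁)
      (by
        refine ((hu.continuousOn.mono hsub).sub ?_).sub ?_
        · exact Continuous.continuousOn (by fun_prop)
        · exact Continuous.continuousOn (by simp only [hH]; fun_prop))
      (by
        intro x
        have := hinit x
        have := mul_pos hε (hHpos x t₀)
        simp only [sub_self, mul_zero, add_zero]
        linarith)
      (by
        intro x hx t ht
        have hAε : 0 ≤ A / ε := by positivity
        have h1 := hgrowth x t ⟨ht₀.trans ht.1, ht.2.trans ht₁.le⟩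
        have h2 : A ≤ ε * Real.exp (‖x‖ ^ 2) := by
          have : A / ε ≤ Real.exp (‖x‖ ^ 2) := by
            have := Real.add_one_le_exp (‖x‖ ^ 2)
            nlinarith
          rwa [div_le_iff₀' hε] at this
        have h3 : Real.exp (‖x‖ ^ 2) * Real.exp (a * ‖x‖ ^ 2) ≤ H x t := by
          rw [← Real.exp_add, hH]
          refine Real.exp_le_exp.2 ?_
          have e1 : 0 ≤ 16 * b * (t - t₀) := by have := ht.1; nlinarith
          have e2 : 0 ≤ (4 * n * b + 1) * (t - t₀) :=
            mul_nonneg (by positivity) (by linarith [ht.1])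
          have e3 : 0 ≤ b * (16 * b * (t - t₀)) * ‖x‖ ^ 2 := by positivity
          rw [sub_zero]
          have e4 : b * ‖x‖ ^ 2 = ‖x‖ ^ 2 + a * ‖x‖ ^ 2 := by rw [hb]; ring
          linarith
        have h4 : A * Real.exp (a * ‖x‖ ^ 2) ≤ ε * H x t :=
          (mul_le_mul_of_nonneg_right h2 (Real.exp_pos _).le).trans (by
            rw [mul_assoc]; gcongr)
        have h5 : 0 ≤ C * ‖x - x₀‖ ^ 2 := by positivity
        have h6 : 0 ≤ (2 * n * C + G) * (t - t₀) :=
          mul_nonneg (by positivity) (by linarith [ht.1])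
        linarith)
      ht hcon
    have hsT : s ∈ Set.Ioo 0 T := ⟨ht₀.trans_lt hs₀, hs₁.trans_lt ht₁⟩
    -- The first two derivatives in `x` at the maximum.
    set β := b * (1 + 16 * b * (s - t₀)) with hβ
    set γ := (4 * n * b + 1) * (s - t₀) with hγ
    have hus := hu.contDiff s hsT
    have hψ1 : ContDiff ℝ 2 fun x => u x s + ((-C) * ‖x - x₀‖ ^ 2
        + (-(c₀ + (2 * n * C + G) * (s - t₀)))) :=
      hus.add ((contDiff_const.mul (contDiff_norm_sub_sq x₀)).add contDiff_const)
    have hψ : ContDiff ℝ 2 fun x => (u x s + ((-C) * ‖x - x₀‖ ^ 2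
        + (-(c₀ + (2 * n * C + G) * (s - t₀)))))
        + ((-ε) * Real.exp (β * ‖x - 0‖ ^ 2 + γ) + 0) :=
      hψ1.add ((contDiff_const.mul (contDiff_exp_norm_sq β γ)).add contDiff_const)
    have hΔ := laplacian_nonpos_of_forall_le (x₀ := y) hψ (by
      intro x
      have := hmaxx x
      simp only [hH, ← hβ, ← hγ] at this
      linarith)
    rw [laplacian_add_const_mul hψ1 (contDiff_exp_norm_sq β γ),
      laplacian_add_const_mul hus (contDiff_norm_sub_sq x₀), laplacian_norm_sub_sq,
      laplacian_exp_norm_sq] at hΔ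
    -- The time derivative at the maximum.
    have hlin : HasDerivAt (fun t => b * (1 + 16 * b * (t - t₀)) * ‖y - 0‖ ^ 2
        + (4 * n * b + 1) * (t - t₀)) (16 * b ^ 2 * ‖y‖ ^ 2 + (4 * n * b + 1)) s := by
      have h1 : HasDerivAt (fun t => t - t₀) 1 s := (hasDerivAt_id' s).sub_const t₀
      refine (((((h1.const_mul (16 * b)).const_add 1).const_mul b).mul_const (‖y - 0‖ ^ 2)).fun_add
        (h1.const_mul (4 * n * b + 1))).congr_deriv ?_
      rw [sub_zero]; ring
    have hlin2 : HasDerivAt (fun t => c₀ + C * ‖y - x₀‖ ^ 2 + (2 * n * C + G) * (t - t₀))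
        (2 * n * C + G) s := by
      refine ((((hasDerivAt_id' s).sub_const t₀).const_mul (2 * n * C + G)).const_add
        (c₀ + C * ‖y - x₀‖ ^ 2)).congr_deriv ?_
      ring
    have hd := deriv_nonneg_of_left_max
      (((hu.hasDerivAt y s hsT).fun_sub hlin2).fun_sub (hlin.exp.const_mul ε)) hs₀ hmaxt
    simp only [sub_zero, ← hβ, ← hγ] at hd
    have hE := mul_pos hε (Real.exp_pos (β * ‖y‖ ^ 2 + γ))
    set E := Real.exp (β * ‖y‖ ^ 2 + γ)
    have hβ1 : β ≤ 2 * b := by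
      have : 16 * b * (s - t₀) ≤ 1 := le_trans (by gcongr) hshort
      nlinarith
    have hβ0 : 0 ≤ β := by
      have : 0 ≤ 16 * b * (s - t₀) := by nlinarith
      positivity
    have hfy := hf y (u y s)
    have hβ2 : β ^ 2 ≤ 4 * b ^ 2 := by nlinarith
    have k1 : 2 * n * β + 4 * β ^ 2 * ‖y‖ ^ 2 ≤ 4 * n * b + 16 * b ^ 2 * ‖y‖ ^ 2 := by
      have k2 : (n : ℝ) * β ≤ n * (2 * b) := by gcongr
      have k3 : β ^ 2 * ‖y‖ ^ 2 ≤ 4 * b ^ 2 * ‖y‖ ^ 2 := by gcongr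
      linarith
    have k4 := mul_le_mul_of_nonneg_left k1 hE.le
    linarith
  have hlim : Filter.Tendsto (fun ε => u x t - (c₀ + C * ‖x - x₀‖ ^ 2
      + (2 * n * C + G) * (t - t₀)) - ε * H x t) (nhdsWithin 0 (Set.Ioi 0))
      (nhds (u x t - (c₀ + C * ‖x - x₀‖ ^ 2 + (2 * n * C + G) * (t - t₀)) - 0 * H x t)) := by
    refine Filter.Tendsto.mono_left ?_ nhdsWithin_le_nhds
    exact (Continuous.tendsto (by fun_prop) _)
  have := le_of_tendsto hlim (Filter.eventually_of_mem self_mem_nhdsWithin main)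
  linarith

namespace IsStrictSupersolution

variable {n : ℕ} {f : Base n → ℝ → ℝ} {Fs F h₀ δ η T : ℝ} {v : Base n → ℝ} {u : Base n → ℝ → ℝ}

/-- As long as `u` exceeds `v` by at most `δ`, it cannot exceed `v` at all: at a maximum of
`u - v - ε (1 + |x|²)` the strict inequality for `v` at height `u` contradicts the equation. -/
lemma le_of_le_add_range (hv : IsStrictSupersolution f Fs h₀ δ η v) (hF : F ≤ Fs)
    (hu : IsSolution f F T u) {t₀ t₁ : ℝ} (ht₀ : 0 ≤ t₀) (ht₁ : t₁ < T)
    (hinit : ∀ x, u x t₀ ≤ v x) (hnear : ∀ x, ∀ t ∈ Set.Icc t₀ t₁, u x t ≤ v x + δ) :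
    ∀ x, ∀ t ∈ Set.Icc t₀ t₁, u x t ≤ v x := by
  intro x t ht
  have hη := hv.margin_pos
  have main : ∀ ε > 0, 2 * n * ε < η → u x t - v x - ε * (1 + ‖x - 0‖ ^ 2) ≤ 0 := by
    intro ε hε hεη
    by_contra hcon
    push Not at hcon
    have hsub : Set.univ ×ˢ Set.Icc t₀ t₁ ⊆ (Set.univ : Set (Base n)) ×ˢ Set.Icc 0 T :=
      Set.prod_mono le_rfl (Set.Icc_subset_Icc ht₀ ht₁.le)
    have hvc := hv.continuous
    obtain ⟨y, s, hs₀, hs₁, hpos, hmaxx, hmaxt⟩ := exists_max_of_pos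
      (Φ := fun x t => u x t - v x - ε * (1 + ‖x - 0‖ ^ 2))
      (R := δ / ε + 1) (t₀ := t₀) (t₁ := t₁)
      (by
        refine ((hu.continuousOn.mono hsub).sub ?_).sub ?_
        · exact Continuous.continuousOn (by fun_prop)
        · exact Continuous.continuousOn (by fun_prop))
      (by
        intro x
        have := hinit x
        have : 0 < ε * (1 + ‖x - 0‖ ^ 2) := by positivity
        linarith)
      (by
        intro x hx t ht
        have h1 := hnear x t ht
        have hδε : 0 < δ / ε := div_pos hv.range_pos hε
        have h2 : δ / ε ≤ 1 + ‖x‖ ^ 2 := by nlinarith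
        rw [div_le_iff₀' hε] at h2
        rw [sub_zero]
        linarith)
      ht hcon
    have hsT : s ∈ Set.Ioo 0 T := ⟨ht₀.trans_lt hs₀, hs₁.trans_lt ht₁⟩
    have hus := hu.contDiff s hsT
    have hψ : ContDiff ℝ 2 fun x => u x s + ((-ε) * ‖x - 0‖ ^ 2 + 0) :=
      hus.add ((contDiff_const.mul (contDiff_norm_sub_sq 0)).add contDiff_const)
    have hvy : v y ≤ u y s := by
      have : 0 < ε * (1 + ‖y - 0‖ ^ 2) := by positivity
      linarith
    have h1 := hv.laplacian_le_of_isLocalMin (x₀ := y) hψ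
      (Filter.Eventually.of_forall fun x => by
        have := hmaxx x
        simp only at this ⊢
        linarith) hvy (hnear y s ⟨hs₀.le, hs₁⟩)
    rw [laplacian_add_const_mul hus (contDiff_norm_sub_sq 0), laplacian_norm_sub_sq] at h1
    have hd := deriv_nonneg_of_left_max
      (((hu.hasDerivAt y s hsT).sub_const (v y)).sub_const (ε * (1 + ‖y - 0‖ ^ 2))) hs₀ hmaxt
    linarith
  have hlim : Filter.Tendsto (fun ε => u x t - v x - ε * (1 + ‖x - 0‖ ^ 2))
      (nhdsWithin 0 (Set.Ioi 0)) (nhds (u x t - v x - 0 * (1 + ‖x - 0‖ ^ 2))) := by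
    refine Filter.Tendsto.mono_left ?_ nhdsWithin_le_nhds
    exact (Continuous.tendsto (by fun_prop) _)
  have hsmall : ∀ᶠ ε in nhdsWithin (0 : ℝ) (Set.Ioi 0), 2 * n * ε < η := by
    have : Filter.Tendsto (fun ε : ℝ => 2 * n * ε) (nhdsWithin 0 (Set.Ioi 0))
        (nhds (2 * n * 0)) :=
      Filter.Tendsto.mono_left (Continuous.tendsto (by fun_prop) _) nhdsWithin_le_nhds
    rw [mul_zero] at this
    exact this.eventually (gt_mem_nhds hη)
  have := le_of_tendsto hlim (by
    filter_upwards [hsmall, self_mem_nhdsWithin] with ε h1 h2 using main ε h2 h1)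
  linarith

/-- Comparison with an arbitrary solution, by induction over time steps of a fixed length `τ`: within
one step a paraboloid above `v` that touches `v + δ / 2` at a given point keeps `u` below
`v + δ`. -/
theorem solution_le (hv : IsStrictSupersolution f Fs h₀ δ η v) (hf : ∀ x y, f x y ≤ 0)
    (hF : F ≤ Fs) (hT : 0 < T) (hu : IsSolution f F T u) (hgrowth : HasGaussianGrowth T u) :
    ∀ x, ∀ t ∈ Set.Icc 0 T, u x t ≤ v x := by
  obtain ⟨A', a', hg'⟩ := hgrowth
  have hg : ∀ x, ∀ t ∈ Set.Icc 0 T, u x t ≤ |A'| * Real.exp (|a'| * ‖x‖ ^ 2) := fun x t ht =>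
    (hg' x t ht).trans (by gcongr <;> exact le_abs_self _)
  obtain ⟨L, hL⟩ := hv.lipschitz
  have hδ := hv.range_pos
  set C : ℝ := (L : ℝ) ^ 2 / (2 * δ) with hC
  have hC0 : 0 ≤ C := by positivity
  set D : ℝ := 2 * n * C + |Fs| with hD
  have hD0 : 0 ≤ D := by positivity
  set τ := min (1 / (16 * (|a'| + 1))) (δ / (2 * (D + 1))) with hτ
  have hτ0 : 0 < τ := by positivity
  have step : ∀ t₀ t₁, 0 ≤ t₀ → t₁ < T → t₁ - t₀ ≤ τ → (∀ x, u x t₀ ≤ v x) →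
      ∀ x, ∀ t ∈ Set.Icc t₀ t₁, u x t ≤ v x := by
    intro t₀ t₁ ht₀ ht₁ hlen hinit
    refine hv.le_of_le_add_range hF hu ht₀ ht₁ hinit fun x t ht => ?_
    have hshort : 16 * (|a'| + 1) * (t₁ - t₀) ≤ 1 := by
      have := hlen.trans (min_le_left _ _)
      rwa [le_div_iff₀' (by positivity)] at this
    have hlen2 : D * (t - t₀) ≤ δ / 2 := by
      have h1 := hlen.trans (min_le_right _ _)
      rw [le_div_iff₀' (by positivity)] at h1
      have := ht.1
      have := ht.2
      nlinarith
    have := hu.le_paraboloid hf (abs_nonneg A') (abs_nonneg a') hg ht₀ ht₁ hshort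
      (c₀ := v x + δ / 2) (by linarith [hv.nonneg x]) hC0 (abs_nonneg Fs)
      (hF.trans (le_abs_self _)) x (fun z => by
        have h1 := hinit z
        have h2 := hL.dist_le_mul z x
        rw [Real.dist_eq, dist_eq_norm] at h2
        have h3 := (abs_le.1 h2).2
        -- `L r ≤ δ / 2 + L² r² / (2 δ)`
        have h4 : (L : ℝ) * ‖z - x‖ ≤ δ / 2 + C * ‖z - x‖ ^ 2 := by
          have : δ / 2 + C * ‖z - x‖ ^ 2 - L * ‖z - x‖
              = (δ - L * ‖z - x‖) ^ 2 / (2 * δ) := by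
            rw [hC]; field_simp; ring
          have : 0 ≤ (δ - L * ‖z - x‖) ^ 2 / (2 * δ) := by positivity
          linarith
        linarith) x t ht
    simp only [sub_self, norm_zero] at this
    linarith
  have iter : ∀ j : ℕ, ∀ t, 0 ≤ t → t < T → t ≤ j * τ → ∀ x, u x t ≤ v x := by
    intro j
    induction j with
    | zero =>
      intro t ht _ ht' x
      have : t = 0 := le_antisymm (by simpa using ht') ht
      rw [this, hu.initial x]
      exact hv.nonneg x
    | succ j ih =>
      intro t ht htT ht' x
      rcases le_or_gt t (j * τ) with h | h
      · exact ih t ht htT h x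
      · push_cast at ht'
        exact step (j * τ) t (by positivity) htT (by linarith)
          (ih _ (by positivity) (h.trans htT) le_rfl) x t ⟨h.le, le_rfl⟩
  have before : ∀ t, 0 ≤ t → t < T → ∀ x, u x t ≤ v x := by
    intro t ht htT
    obtain ⟨j, hj⟩ := exists_nat_ge (t / τ)
    exact iter j t ht htT ((div_le_iff₀ hτ0).1 hj)
  intro x t ht
  rcases lt_or_eq_of_le ht.2 with h | rfl
  · exact before t ht.1 h x
  · have hc : ContinuousWithinAt (fun s => u x s) (Set.Icc 0 t) t := by
      have h1 := hu.continuousOn (x, t) ⟨trivial, ht⟩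
      exact h1.comp (f := fun s => (x, s)) (by fun_prop : Continuous fun s : ℝ => (x, s)).continuousWithinAt
        (fun s hs => ⟨trivial, hs⟩)
    have hc' := hc.mono (Set.Ico_subset_Icc_self)
    have : (nhdsWithin t (Set.Ico 0 t)).NeBot := by
      rw [← mem_closure_iff_nhdsWithin_neBot, closure_Ico hT.ne]
      exact ht
    exact le_of_tendsto hc' (by
      filter_upwards [self_mem_nhdsWithin] with s hs using before s hs.1 hs.2 x)

end IsStrictSupersolution

/-! ### The profile of a single obstacle -/

/-- The function `s ↦ A (a⁻ᵐ - (a + s)⁻ᵐ)`, to be evaluated at `s = |x|²`. -/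
def profile (A a m s : ℝ) : ℝ := A * (a ^ (-m) - (a + s) ^ (-m))

lemma hasDerivAt_const_add_rpow {a s : ℝ} (h : a + s ≠ 0) (p : ℝ) :
    HasDerivAt (fun s => (a + s) ^ p) (p * (a + s) ^ (p - 1)) s := by
  have h1 : HasDerivAt (fun s => a + s) 1 s := (hasDerivAt_id' s).const_add a
  exact (h1.rpow_const (p := p) (Or.inl h)).congr_deriv (by ring)

lemma hasDerivAt_profile {A a m s : ℝ} (h : a + s ≠ 0) :
    HasDerivAt (profile A a m) (A * m * (a + s) ^ (-m - 1)) s := by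
  refine (((hasDerivAt_const_add_rpow h (-m)).const_sub (a ^ (-m))).const_mul A).congr_deriv ?_
  ring

lemma hasDerivAt_profile_deriv {A a m s : ℝ} (h : a + s ≠ 0) :
    HasDerivAt (fun s => A * m * (a + s) ^ (-m - 1))
      (-(A * m * (m + 1) * (a + s) ^ (-m - 2))) s := by
  refine ((hasDerivAt_const_add_rpow h (-m - 1)).const_mul (A * m)).congr_deriv ?_
  rw [show -m - 1 - 1 = -m - 2 by ring]
  ring

lemma contDiff_profile {n : ℕ} {A a m : ℝ} (ha : 0 < a) :
    ContDiff ℝ 2 fun x : Base n => profile A a m (‖x - 0‖ ^ 2) := by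
  unfold profile
  refine contDiff_const.mul (contDiff_const.sub ?_)
  refine (contDiff_const.add (contDiff_norm_sub_sq 0)).rpow_const_of_ne fun x => ?_
  positivity

lemma laplacian_profile {n : ℕ} {A a m : ℝ} (ha : 0 < a) (x : Base n) :
    Laplacian.laplacian (fun x : Base n => profile A a m (‖x - 0‖ ^ 2)) x
      = 2 * A * m * (a + ‖x‖ ^ 2) ^ (-m - 2) * (n * a - (2 * m + 2 - n) * ‖x‖ ^ 2) := by
  rw [laplacian_radial 0 (fun s hs => hasDerivAt_profile (by positivity))
    (fun s hs => hasDerivAt_profile_deriv (by positivity)) (contDiff_profile ha), sub_zero]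
  have h : 0 < a + ‖x‖ ^ 2 := by positivity
  have : (a + ‖x‖ ^ 2) ^ (-m - 1) = (a + ‖x‖ ^ 2) ^ (-m - 2) * (a + ‖x‖ ^ 2) := by
    rw [← Real.rpow_add_one h.ne']
    ring_nf
  rw [this]
  ring

lemma profile_mono {A a m s t : ℝ} (hA : 0 ≤ A) (ha : 0 < a) (hm : 0 ≤ m) (hs : 0 ≤ s)
    (hst : s ≤ t) : profile A a m s ≤ profile A a m t := by
  unfold profile
  have : (a + t) ^ (-m) ≤ (a + s) ^ (-m) :=
    Real.rpow_le_rpow_of_nonpos (by positivity) (by linarith) (by linarith)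
  gcongr

lemma exists_lipschitzWith_profile {n : ℕ} {A a m : ℝ} (hA : 0 ≤ A) (ha : 0 < a) (hm : 0 ≤ m) :
    ∃ L : ℝ≥0, LipschitzWith L fun x : Base n => profile A a m (‖x - 0‖ ^ 2) := by
  have hd : ∀ r : ℝ, HasDerivAt (fun r => profile A a m (r ^ 2))
      (A * m * (a + r ^ 2) ^ (-m - 1) * (2 * r)) r := fun r =>
    (hasDerivAt_profile (by positivity)).comp r
      (((hasDerivAt_id' r).fun_pow 2).congr_deriv (by ring))
  have hb : ∀ r : ℝ, ‖A * m * (a + r ^ 2) ^ (-m - 1) * (2 * r)‖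
      ≤ 2 * (A * m) * a ^ (-m) * (1 / a + 1) := by
    intro r
    have h : 0 < a + r ^ 2 := by positivity
    have h1 : (a + r ^ 2) ^ (-m) ≤ a ^ (-m) :=
      Real.rpow_le_rpow_of_nonpos ha (by nlinarith) (by linarith)
    have h2 : |r| / (a + r ^ 2) ≤ 1 / a + 1 := by
      rw [div_le_iff₀ h]
      have : 0 ≤ r ^ 2 * (1 / a) := by positivity
      have h3 : a * (1 / a) = 1 := by field_simp
      have h4 : |r| ≤ 1 + r ^ 2 := by
        rw [← sq_abs r]; nlinarith [abs_nonneg r]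
      nlinarith
    have h5 : 0 ≤ |r| / (a + r ^ 2) := by positivity
    rw [Real.norm_eq_abs, abs_mul, abs_mul, abs_mul, abs_mul, abs_of_nonneg hA, abs_of_nonneg hm,
      Real.rpow_sub_one h.ne', abs_of_pos (div_pos (Real.rpow_pos_of_pos h _) h), abs_two]
    calc A * m * ((a + r ^ 2) ^ (-m) / (a + r ^ 2)) * (2 * |r|)
        = 2 * (A * m) * (a + r ^ 2) ^ (-m) * (|r| / (a + r ^ 2)) := by ring
      _ ≤ _ := by gcongr
  have hlip : LipschitzWith (Real.toNNReal (2 * (A * m) * a ^ (-m) * (1 / a + 1)))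
      (fun r : ℝ => profile A a m (r ^ 2)) := by
    refine lipschitzWith_of_nnnorm_deriv_le (fun r => (hd r).differentiableAt) fun r => ?_
    rw [(hd r).deriv, ← NNReal.coe_le_coe, coe_nnnorm, Real.coe_toNNReal _ (by positivity)]
    exact hb r
  simp only [sub_zero]
  exact ⟨_, hlip.comp (lipschitzWith_one_norm (E := Base n))⟩

set_option maxHeartbeats 800000 in
/-- The scale argument: a profile which curves upwards by at most `c` on the ball of radius `r₀` and
is strictly superharmonic beyond it can be chosen together with a length `ℓ` such that the profile
rises between distance `n ℓ` and distance `2 n ℓ` by a prescribed multiple of `ℓ⁻ⁿ`. This is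
possible because the exponent `2 m = n - 1/2` of its decay lies strictly between `n - 2`, the
threshold for superharmonicity, and `n`. -/
lemma exists_profile {n : ℕ} (hn : 1 ≤ n) {r₀ c : ℝ} (B : ℝ) (hr₀ : 0 < r₀) (hc : 0 < c) :
    ∃ (W : Base n → ℝ) (ℓ Fs h₀ : ℝ), 1 ≤ ℓ ∧ 0 < Fs ∧ 0 < h₀ ∧
      (∃ L : ℝ≥0, LipschitzWith L W) ∧ (∀ x, 0 ≤ W x) ∧ (∀ x, W x ≤ r₀ / 2) ∧
      (∀ x y, ‖x‖ ≤ n * ℓ → 2 * n * ℓ ≤ ‖y‖ → W x + B / ℓ ^ n ≤ W y) ∧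
      (∀ x h, 0 < h → h < h₀ → ‖x‖ ≤ 2 * n * ℓ → secondDiff h W x ≤ (c - Fs) * h ^ 2) ∧
      (∀ x h, 0 < h → h < h₀ → ‖x‖ ≤ 2 * n * ℓ → r₀ ≤ ‖x‖ → secondDiff h W x ≤ -Fs * h ^ 2) := by
  have hn1 : (1 : ℝ) ≤ n := by exact_mod_cast hn
  have hn0 : (0 : ℝ) < n := by linarith
  set m : ℝ := n / 2 - 1 / 4 with hm
  have hm0 : 0 < m := by linarith
  set a : ℝ := 3 * r₀ ^ 2 / (4 * n) with ha
  have ha0 : 0 < a := by positivity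
  have hna : n * a = 3 / 4 * r₀ ^ 2 := by rw [ha]; field_simp
  set A : ℝ := min (r₀ / 2 * a ^ m) (c / (4 * m * (n * a) * a ^ (-m - 2))) with hA
  have hpa : 0 < a ^ (-m - 2) := Real.rpow_pos_of_pos ha0 _
  have hpm : 0 < a ^ m := Real.rpow_pos_of_pos ha0 _
  have hA0 : 0 < A := lt_min (by positivity) (by positivity)
  have hA1 : A * a ^ (-m) ≤ r₀ / 2 := by
    have : A ≤ r₀ / 2 * a ^ m := min_le_left _ _
    rw [Real.rpow_neg ha0.le, ← div_eq_mul_inv, div_le_iff₀ hpm]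
    exact this
  have hA2 : A * (4 * m * (n * a) * a ^ (-m - 2)) ≤ c := by
    have : A ≤ c / (4 * m * (n * a) * a ^ (-m - 2)) := min_le_right _ _
    rwa [le_div_iff₀ (by positivity)] at this
  -- The choice of the length scale.
  have h2m : 0 < 1 - (2 : ℝ) ^ (-m) := by
    have : (2 : ℝ) ^ (-m) < 1 := Real.rpow_lt_one_of_one_lt_of_neg (by norm_num) (by linarith)
    linarith
  set q : ℝ := A * ((1 - 2 ^ (-m)) * (3 ^ (-m) * (n : ℝ) ^ (-(2 * m)))) with hq
  have hq0 : 0 < q := by positivity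
  set ℓ : ℝ := 1 + a + (B / q) ^ 2 with hℓ
  have hℓ1 : 1 ≤ ℓ := by
    have : 0 ≤ (B / q) ^ 2 := sq_nonneg _
    linarith
  have hℓ0 : 0 < ℓ := by linarith
  have hℓa : a ≤ 2 * (n * ℓ) ^ 2 := by
    have h1 : a ≤ ℓ := by have : 0 ≤ (B / q) ^ 2 := sq_nonneg _; linarith
    have h2 : ℓ ≤ n * ℓ := by nlinarith
    nlinarith
  have hℓq : B ≤ q * ℓ ^ (1 / 2 : ℝ) := by
    rw [← Real.sqrt_eq_rpow, ← div_le_iff₀' hq0]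
    refine (le_abs_self _).trans ?_
    rw [← Real.sqrt_sq_eq_abs]
    exact Real.sqrt_le_sqrt (by linarith)
  set κ : ℝ := (a + (2 * n * ℓ) ^ 2) ^ (-m - 2) with hκ
  have hκ0 : 0 < κ := Real.rpow_pos_of_pos (by positivity) _
  set c₁ : ℝ := 2 * A * m * κ * (3 / 4 * r₀ ^ 2) with hc₁
  have hc₁0 : 0 < c₁ := by positivity
  set Fs : ℝ := min (c / 4) (c₁ / 2) with hFs
  have hFs0 : 0 < Fs := lt_min (by positivity) (by positivity)
  have hFs1 : Fs ≤ c / 4 := min_le_left _ _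
  have hFs2 : Fs ≤ c₁ / 2 := min_le_right _ _
  clear_value Fs c₁ κ ℓ q A a m
  obtain ⟨h₀, hh₀, H⟩ := exists_abs_secondDiff_sub_laplacian_le
    (contDiff_profile (n := n) (A := A) (m := m) ha0)
    (isCompact_closedBall (0 : Base n) (2 * n * ℓ)) hFs0
  have hΔ : ∀ x : Base n, Laplacian.laplacian (fun x : Base n => profile A a m (‖x - 0‖ ^ 2)) x
      = 2 * A * m * (a + ‖x‖ ^ 2) ^ (-m - 2) * (3 / 4 * r₀ ^ 2 - 3 / 2 * ‖x‖ ^ 2) := by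
    intro x
    rw [laplacian_profile ha0, hna, hm]
    ring
  refine ⟨fun x => profile A a m (‖x - 0‖ ^ 2), ℓ, Fs, h₀, hℓ1, hFs0, hh₀,
    exists_lipschitzWith_profile hA0.le ha0 hm0.le, fun x => ?_, fun x => ?_,
    fun x y hx hy => ?_, fun x h hh hlt hx => ?_, fun x h hh hlt hx hx' => ?_⟩
  · have := profile_mono (m := m) hA0.le ha0 hm0.le le_rfl (sq_nonneg ‖x - 0‖)
    simpa [profile] using this
  · have : 0 ≤ A * (a + ‖x - 0‖ ^ 2) ^ (-m) := by positivity
    simp only [profile, mul_sub]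
    linarith
  · set ρ : ℝ := n * ℓ with hρ
    have hρ0 : 0 < ρ := by positivity
    have h1 : profile A a m (‖x - 0‖ ^ 2) ≤ profile A a m (ρ ^ 2) :=
      profile_mono hA0.le ha0 hm0.le (sq_nonneg _) (by rw [sub_zero]; gcongr)
    have h2 : profile A a m (4 * ρ ^ 2) ≤ profile A a m (‖y - 0‖ ^ 2) := by
      refine profile_mono hA0.le ha0 hm0.le (by positivity) ?_
      rw [sub_zero, show 4 * ρ ^ 2 = (2 * n * ℓ) ^ 2 by rw [hρ]; ring]
      gcongr
    have h3 : (a + 4 * ρ ^ 2) ^ (-m) ≤ 2 ^ (-m) * (a + ρ ^ 2) ^ (-m) := by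
      rw [← Real.mul_rpow (by norm_num) (by positivity)]
      exact Real.rpow_le_rpow_of_nonpos (by positivity) (by linarith) (by linarith)
    have h4 : 3 ^ (-m) * ρ ^ (-(2 * m)) ≤ (a + ρ ^ 2) ^ (-m) := by
      have : ρ ^ (-(2 * m)) = (ρ ^ 2) ^ (-m) := by
        rw [← Real.rpow_natCast, ← Real.rpow_mul hρ0.le]
        norm_num
      rw [this, ← Real.mul_rpow (by norm_num) (by positivity)]
      exact Real.rpow_le_rpow_of_nonpos (by positivity) (by linarith) (by linarith)
    have h5 : ρ ^ (-(2 * m)) = (n : ℝ) ^ (-(2 * m)) * (ℓ ^ (1 / 2 : ℝ) / ℓ ^ n) := by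
      rw [hρ, Real.mul_rpow hn0.le hℓ0.le]
      congr 1
      rw [← Real.rpow_natCast, ← Real.rpow_sub hℓ0]
      congr 1
      rw [hm]; ring
    have h6 : B / ℓ ^ n ≤ A * ((1 - 2 ^ (-m)) * (3 ^ (-m) * ρ ^ (-(2 * m)))) := by
      rw [h5]
      calc B / ℓ ^ n ≤ q * ℓ ^ (1 / 2 : ℝ) / ℓ ^ n := by gcongr
        _ = _ := by rw [hq]; ring
    have h7 : A * ((1 - 2 ^ (-m)) * (3 ^ (-m) * ρ ^ (-(2 * m))))
        ≤ A * ((a + ρ ^ 2) ^ (-m) - (a + 4 * ρ ^ 2) ^ (-m)) := by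
      have := mul_le_mul_of_nonneg_left h4 h2m.le
      gcongr
      linarith
    have h8 : profile A a m (4 * ρ ^ 2) - profile A a m (ρ ^ 2)
        = A * ((a + ρ ^ 2) ^ (-m) - (a + 4 * ρ ^ 2) ^ (-m)) := by
      simp only [profile]; ring
    linarith
  · have h1 := (abs_le.1 (H h hh hlt x (mem_closedBall_zero_iff.2 hx))).2
    have h2 : Laplacian.laplacian (fun x : Base n => profile A a m (‖x - 0‖ ^ 2)) x ≤ c / 2 := by
      rw [hΔ]
      have e1 : (a + ‖x‖ ^ 2) ^ (-m - 2) ≤ a ^ (-m - 2) :=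
        Real.rpow_le_rpow_of_nonpos ha0 (by nlinarith [sq_nonneg ‖x‖]) (by linarith)
      have e0 : 0 ≤ (a + ‖x‖ ^ 2) ^ (-m - 2) := by positivity
      calc 2 * A * m * (a + ‖x‖ ^ 2) ^ (-m - 2) * (3 / 4 * r₀ ^ 2 - 3 / 2 * ‖x‖ ^ 2)
          ≤ 2 * A * m * (a + ‖x‖ ^ 2) ^ (-m - 2) * (3 / 4 * r₀ ^ 2) := by
            gcongr
            nlinarith [sq_nonneg ‖x‖]
        _ ≤ 2 * A * m * a ^ (-m - 2) * (3 / 4 * r₀ ^ 2) := by gcongr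
        _ ≤ c / 2 := by rw [← hna]; linarith
    have h3 : 0 < h ^ 2 := by positivity
    nlinarith
  · have h1 := (abs_le.1 (H h hh hlt x (mem_closedBall_zero_iff.2 hx))).2
    have h2 : Laplacian.laplacian (fun x : Base n => profile A a m (‖x - 0‖ ^ 2)) x ≤ -c₁ := by
      rw [hΔ]
      have e1 : κ ≤ (a + ‖x‖ ^ 2) ^ (-m - 2) := by
        rw [hκ]
        exact Real.rpow_le_rpow_of_nonpos (by positivity) (by gcongr) (by linarith)
      have e2 : 3 / 4 * r₀ ^ 2 ≤ 3 / 2 * ‖x‖ ^ 2 - 3 / 4 * r₀ ^ 2 := by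
        have : r₀ ^ 2 ≤ ‖x‖ ^ 2 := by gcongr
        linarith
      have e3 : 2 * A * m * κ * (3 / 4 * r₀ ^ 2)
          ≤ 2 * A * m * (a + ‖x‖ ^ 2) ^ (-m - 2) * (3 / 2 * ‖x‖ ^ 2 - 3 / 4 * r₀ ^ 2) := by
        gcongr
      linarith
    have h3 : 0 < h ^ 2 := by positivity
    nlinarith

/-! ### The lower envelope of translated profiles -/

/-- The lower envelope of the translates of `W` to the points `p k` with `k ∈ I`. -/
def envelope {n : ℕ} (W : Base n → ℝ) (I : Set ℕ) (p : ℕ → Ambient n) (x : Base n) : ℝ :=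
  ⨅ k : I, ((p k).2 + W (x - (p k).1))

/-- `W` with a cone of slope `K` added outside the ball of radius `R`. -/
def addCone {n : ℕ} (W : Base n → ℝ) (K R : ℝ) (x : Base n) : ℝ := W x + K * max (‖x‖ - R) 0

section

variable {n : ℕ} {W : Base n → ℝ} {I : Set ℕ} {p : ℕ → Ambient n} {K R : ℝ}

lemma le_addCone (hK : 0 ≤ K) (x : Base n) : W x ≤ addCone W K R x := by
  have : 0 ≤ K * max (‖x‖ - R) 0 := mul_nonneg hK (le_max_right _ _)
  unfold addCone
  linarith

lemma addCone_of_norm_le {x : Base n} (hx : ‖x‖ ≤ R) : addCone W K R x = W x := by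
  simp [addCone, max_eq_right (sub_nonpos.2 hx)]

lemma lipschitzWith_addCone {L : ℝ≥0} (hW : LipschitzWith L W) (K : ℝ≥0) :
    LipschitzWith (L + K) (addCone W K R) := by
  refine LipschitzWith.of_dist_le_mul fun x y => ?_
  have h1 := hW.dist_le_mul x y
  rw [Real.dist_eq] at h1 ⊢
  have h2 : |max (‖x‖ - R) 0 - max (‖y‖ - R) 0| ≤ dist x y := by
    refine (abs_max_sub_max_le_abs _ _ _).trans ?_
    rw [sub_sub_sub_cancel_right, dist_eq_norm]
    exact abs_norm_sub_norm_le x y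
  have h3 : addCone W K R x - addCone W K R y
      = (W x - W y) + K * (max (‖x‖ - R) 0 - max (‖y‖ - R) 0) := by
    unfold addCone; ring
  rw [h3]
  refine (abs_add_le _ _).trans ?_
  rw [abs_mul, NNReal.abs_eq]
  push_cast
  rw [add_mul]
  gcongr

lemma bddBelow_envelope (hW : ∀ x, 0 ≤ W x) (hp : ∀ k ∈ I, 0 ≤ (p k).2) (x : Base n) :
    BddBelow (Set.range fun k : I => (p k).2 + W (x - (p k).1)) := by
  refine ⟨0, ?_⟩
  rintro _ ⟨k, rfl⟩
  exact add_nonneg (hp k k.2) (hW _)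

lemma envelope_le (hW : ∀ x, 0 ≤ W x) (hp : ∀ k ∈ I, 0 ≤ (p k).2) (x : Base n) {k : ℕ}
    (hk : k ∈ I) : envelope W I p x ≤ (p k).2 + W (x - (p k).1) :=
  ciInf_le (bddBelow_envelope hW hp x) ⟨k, hk⟩

lemma envelope_nonneg (hW : ∀ x, 0 ≤ W x) (hp : ∀ k ∈ I, 0 ≤ (p k).2) (x : Base n) :
    0 ≤ envelope W I p x :=
  Real.iInf_nonneg fun k => add_nonneg (hp k k.2) (hW _)

lemma lipschitzWith_envelope {L : ℝ≥0} (hL : LipschitzWith L W) (hW : ∀ x, 0 ≤ W x)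
    (hp : ∀ k ∈ I, 0 ≤ (p k).2) (hI : I.Nonempty) : LipschitzWith L (envelope W I p) := by
  have := hI.to_subtype
  refine LipschitzWith.of_le_add_mul L fun x y => ?_
  rw [← sub_le_iff_le_add]
  refine le_ciInf fun k => ?_
  have h1 := envelope_le hW hp x k.2
  have h2 := hL.dist_le_mul (x - (p k).1) (y - (p k).1)
  rw [Real.dist_eq, dist_sub_right] at h2
  have h3 := (abs_le.1 h2).2
  linarith

/-- The envelope of profiles centred at the points `p k` is a strict supersolution if obstacles of
strength `c` sit at these points, the points are everywhere within reach, and their heights vary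
slowly. A profile that is (almost) active at `x` then has its centre within distance `2 n ℓ` of `x`:
if it did not, the profile of a point nearby would be lower by `hgt`. -/
lemma isStrictSupersolution_envelope {r₀ c ℓ Fs h₀ hgt : ℝ} {f : Base n → ℝ → ℝ} (hr₀ : 0 < r₀)
    (hℓ : 1 ≤ ℓ) (hFs : 0 < Fs) (hh₀ : 0 < h₀) (hhgt : 0 < hgt)
    (hlip : ∃ L : ℝ≥0, LipschitzWith L W) (hW : ∀ x, 0 ≤ W x) (hW' : ∀ x, W x ≤ r₀ / 2)
    (hgap : ∀ x y, ‖x‖ ≤ n * ℓ → 2 * n * ℓ ≤ ‖y‖ →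
      W x + (3 * n ^ 2 + 2 * n + 2) * hgt ≤ W y)
    (hin : ∀ x h, 0 < h → h < h₀ → ‖x‖ ≤ 2 * n * ℓ → secondDiff h W x ≤ (c - Fs) * h ^ 2)
    (hout : ∀ x h, 0 < h → h < h₀ → ‖x‖ ≤ 2 * n * ℓ → r₀ ≤ ‖x‖ →
      secondDiff h W x ≤ -Fs * h ^ 2)
    (hf : ∀ x y, f x y ≤ 0)
    (hfc : ∀ k ∈ I, ∀ x y, ‖x - (p k).1‖ ≤ r₀ → |y - (p k).2| ≤ r₀ → f x y ≤ -c)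
    (hp : ∀ k ∈ I, 0 ≤ (p k).2) (hcov : ∀ x, ∃ k ∈ I, ‖x - (p k).1‖ ≤ n * ℓ)
    (hslow : ∀ k ∈ I, ∀ k' ∈ I,
      (p k).2 - (p k').2 ≤ hgt * (n * ‖(p k).1 - (p k').1‖ / ℓ + n + 1)) :
    IsStrictSupersolution f (Fs / 2) (min h₀ 1) (r₀ / 4) (Fs / 2)
      (envelope (addCone W (hgt * n / ℓ) (2 * n * ℓ + 1)) I p) := by
  have hℓ0 : 0 < ℓ := by linarith
  have hK : 0 ≤ hgt * n / ℓ := by positivity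
  set V := addCone W (hgt * n / ℓ) (2 * n * ℓ + 1) with hV
  have hV0 : ∀ x, 0 ≤ V x := fun x => (hW x).trans (le_addCone hK x)
  have hVW : ∀ x : Base n, ‖x‖ ≤ 2 * n * ℓ + 1 → V x = W x := fun x hx => addCone_of_norm_le hx
  refine ⟨envelope_nonneg hV0 hp, ?_, lt_min hh₀ one_pos, by positivity, by positivity, ?_⟩
  · obtain ⟨L, hL⟩ := hlip
    obtain ⟨k, hk, -⟩ := hcov 0
    exact ⟨_, lipschitzWith_envelope (lipschitzWith_addCone hL ⟨_, hK⟩) hV0 hp ⟨k, hk⟩⟩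
  · intro x h y hh hlt hy hy'
    rw [lt_min_iff] at hlt
    by_contra hcon
    push Not at hcon
    set Z := secondDiff h (envelope V I p) x + (f x y + Fs / 2 + Fs / 2) * h ^ 2 with hZ
    set ε := min (min (hgt / 2) r₀) (Z / (2 * n + 1)) with hε
    have hε0 : 0 < ε := by positivity
    have hε1 : ε ≤ hgt / 2 := (min_le_left _ _).trans (min_le_left _ _)
    have hε2 : ε ≤ r₀ := (min_le_left _ _).trans (min_le_right _ _)
    have hε3 : (2 * n + 1) * ε ≤ Z := by
      have : ε ≤ Z / (2 * n + 1) := min_le_right _ _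
      rwa [le_div_iff₀' (by positivity)] at this
    obtain ⟨k₀, hk₀, hxk₀⟩ := hcov x
    have hne : Nonempty I := ⟨⟨k₀, hk₀⟩⟩
    obtain ⟨⟨k, hk⟩, hkε⟩ := exists_lt_of_ciInf_lt
      (lt_add_of_pos_right (envelope V I p x) hε0)
    simp only at hkε
    -- The almost active profile is centred near `x`.
    have hdist : ‖x - (p k).1‖ < 2 * n * ℓ := by
      by_contra hfar
      push Not at hfar
      have a1 := envelope_le hV0 hp x hk₀
      rw [hVW _ (hxk₀.trans (by nlinarith))] at a1
      have a2 := hgap _ _ hxk₀ hfar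
      have a3 := hslow k₀ hk₀ k hk
      have a4 : ‖(p k₀).1 - (p k).1‖ ≤ n * ℓ + ‖x - (p k).1‖ := by
        have : (p k₀).1 - (p k).1 = (x - (p k).1) - (x - (p k₀).1) := by abel
        rw [this]
        linarith [norm_sub_le (x - (p k).1) (x - (p k₀).1)]
      set d := ‖x - (p k).1‖
      have a5 : (p k₀).2 - (p k).2 ≤ hgt * (n * (n * ℓ + d) / ℓ + n + 1) :=
        a3.trans (by gcongr)
      have a6 : hgt * (n * (n * ℓ + d) / ℓ + n + 1)
          = hgt * n / ℓ * (d - (2 * n * ℓ + 1)) + hgt * (3 * n ^ 2 + n / ℓ + n + 1) := by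
        field_simp; ring
      have a7 : (n : ℝ) / ℓ ≤ n := div_le_self (by positivity) hℓ
      have a8 : W (x - (p k).1) + hgt * n / ℓ * (d - (2 * n * ℓ + 1)) ≤ V (x - (p k).1) := by
        rw [hV, addCone]
        gcongr
        exact le_max_left _ _
      have a9 : hgt * (3 * n ^ 2 + n / ℓ + n + 1) ≤ hgt * (3 * n ^ 2 + n + n + 1) := by gcongr
      nlinarith
    have hnear : ∀ z : Base n, ‖z‖ ≤ 1 → V (x - (p k).1 + z) = W (x - (p k).1 + z) := by
      intro z hz
      exact hVW _ ((norm_add_le _ _).trans (by linarith))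
    have hVx : V (x - (p k).1) = W (x - (p k).1) := by simpa using hnear 0 (by simp)
    rw [hVx] at hkε
    have hsd : secondDiff h (envelope V I p) x ≤ secondDiff h W (x - (p k).1) + 2 * n * ε := by
      have : secondDiff h W (x - (p k).1) + 2 * n * ε = ∑ i : Fin n,
          (W (x - (p k).1 + h • unitVec i) + W (x - (p k).1 - h • unitVec i)
            - 2 * W (x - (p k).1) + 2 * ε) := by
        rw [Finset.sum_add_distrib, secondDiff]
        simp
        ring
      rw [this]
      refine Finset.sum_le_sum fun i _ => ?_
      have hn1 : ‖h • (unitVec i : Base n)‖ ≤ 1 := by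
        rw [norm_smul_unitVec, abs_of_pos hh]; exact hlt.2.le
      have b1 := envelope_le hV0 hp (x + h • unitVec i) hk
      have b2 := envelope_le hV0 hp (x - h • unitVec i) hk
      rw [add_sub_right_comm, hnear _ hn1] at b1
      rw [sub_right_comm, sub_eq_add_neg (x - (p k).1), hnear _ (by rwa [norm_neg]),
        ← sub_eq_add_neg] at b2
      linarith
    have hh2 : 0 < h ^ 2 := by positivity
    have hmain : secondDiff h W (x - (p k).1) + (f x y + Fs / 2 + Fs / 2) * h ^ 2 ≤ 0 := by
      rcases le_or_gt ‖x - (p k).1‖ r₀ with hle | hgt'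
      · have c1 := hin _ h hh hlt.1 hdist.le
        have c2 : f x y ≤ -c := by
          refine hfc k hk x y hle (abs_le.2 ⟨?_, ?_⟩)
          · have := hW (x - (p k).1)
            linarith
          · have c3 := envelope_le hV0 hp x hk
            rw [hVx] at c3
            have := hW' (x - (p k).1)
            linarith
        nlinarith
      · have c1 := hout _ h hh hlt.1 hdist.le hgt'.le
        have c2 := hf x y
        nlinarith
    linarith

end

/-! ### Lipschitz percolation -/

/-- Sites of the half space `ℤⁿ × ℕ`, the second component being the height. -/
abbrev Site (n : ℕ) : Type := (Fin n → ℤ) × ℕ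

/-- The signed unit vector of `ℤⁿ` in the direction `e.1`. -/
def signedUnit {n : ℕ} (e : Fin n × Bool) : Fin n → ℤ := Pi.single e.1 (if e.2 then 1 else -1)

/-- A path in `ℤⁿ × ℕ` from height `0` to the given site, encoded by the moves met when it is followed
backwards. Forwards, a path goes straight up by one (`none`) only if it thereby enters a site of
the set `c`, and it may always go down by one while moving to a neighbouring column (`some e`). -/
def IsPathTo {n : ℕ} (c : Set (Site n)) : List (Option (Fin n × Bool)) → Site n → Prop
  | [], p => p.2 = 0
  | none :: w, p => p ∈ c ∧ 0 < p.2 ∧ IsPathTo c w (p.1, p.2 - 1)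
  | some e :: w, p => IsPathTo c w (p.1 + signedUnit e, p.2 + 1)

/-- The site `p` can be reached from height `0`. -/
def Reachable {n : ℕ} (c : Set (Site n)) (p : Site n) : Prop := ∃ w, IsPathTo c w p

/-- The sites which a path, followed backwards from the given site, enters by a move straight up. -/
def upSites {n : ℕ} : List (Option (Fin n × Bool)) → Site n → List (Site n)
  | [], _ => []
  | none :: w, p => p :: upSites w (p.1, p.2 - 1)
  | some e :: w, p => upSites w (p.1 + signedUnit e, p.2 + 1)

section

variable {n : ℕ} {c : Set (Site n)}

lemma IsPathTo.upSites_subset {w : List (Option (Fin n × Bool))} {p : Site n}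
    (h : IsPathTo c w p) : ∀ q ∈ upSites w p, q ∈ c := by
  induction w generalizing p with
  | nil => simp [upSites]
  | cons m w ih =>
    cases m with
    | none =>
      intro q hq
      rcases List.mem_cons.1 hq with rfl | hq
      · exact h.1
      · exact ih h.2.2 q hq
    | some e => exact ih (p := (p.1 + signedUnit e, p.2 + 1)) h

lemma IsPathTo.length_add_height {w : List (Option (Fin n × Bool))} {p : Site n}
    (h : IsPathTo c w p) : w.length + p.2 = 2 * (upSites w p).length := by
  induction w generalizing p with
  | nil => simpa [upSites, IsPathTo] using h
  | cons m w ih =>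
    cases m with
    | none =>
      have h1 := ih h.2.2
      have h2 := h.2.1
      simp only [upSites, List.length_cons] at h1 ⊢
      omega
    | some e =>
      have h1 := ih (p := (p.1 + signedUnit e, p.2 + 1)) h
      simp only [upSites, List.length_cons] at h1 ⊢
      omega

lemma IsPathTo.exists_of_mem_upSites {w : List (Option (Fin n × Bool))} {p q : Site n}
    (h : IsPathTo c w p) (hq : q ∈ upSites w p) :
    ∃ w', IsPathTo c w' q ∧ w'.length ≤ w.length := by
  induction w generalizing p with
  | nil => simp [upSites] at hq
  | cons m w ih =>
    cases m with
    | none =>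
      rcases List.mem_cons.1 hq with rfl | hq
      · exact ⟨_, h, le_rfl⟩
      · obtain ⟨w', h1, h2⟩ := ih h.2.2 hq
        exact ⟨w', h1, h2.trans (by simp)⟩
    | some e =>
      obtain ⟨w', h1, h2⟩ := ih (p := (p.1 + signedUnit e, p.2 + 1)) h hq
      exact ⟨w', h1, h2.trans (by simp)⟩

/-- A shortest path does not enter the same site by two moves straight up. -/
lemma IsPathTo.nodup_upSites {w : List (Option (Fin n × Bool))} {p : Site n}
    (h : IsPathTo c w p) (hmin : ∀ w', IsPathTo c w' p → w.length ≤ w'.length) :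
    (upSites w p).Nodup := by
  induction w generalizing p with
  | nil => simp [upSites]
  | cons m w ih =>
    cases m with
    | none =>
      refine List.nodup_cons.2 ⟨fun hmem => ?_, ih h.2.2 fun w' hw' => ?_⟩
      · obtain ⟨w', h1, h2⟩ := h.2.2.exists_of_mem_upSites hmem
        have := hmin w' h1
        simp only [List.length_cons] at this
        omega
      · simpa using hmin (none :: w') ⟨h.1, h.2.1, hw'⟩
    | some e =>
      exact ih (p := (p.1 + signedUnit e, p.2 + 1)) h fun w' hw' => by
        simpa using hmin (some e :: w') hw'

lemma Reachable.exists_nodup {p : Site n} (h : Reachable c p) :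
    ∃ w, IsPathTo c w p ∧ (upSites w p).Nodup := by
  classical
  obtain ⟨w, hw, hmin⟩ := exists_minimalFor_of_wellFoundedLT (IsPathTo c · p) List.length h
  refine ⟨w, hw, hw.nodup_upSites fun w' hw' => ?_⟩
  by_contra hlt
  push Not at hlt
  exact absurd (hmin hw' hlt.le) (not_le.2 hlt)

lemma reachable_zero (z : Fin n → ℤ) : Reachable c (z, 0) := ⟨[], rfl⟩

lemma Reachable.up {z : Fin n → ℤ} {k : ℕ} (h : Reachable c (z, k)) (hc : (z, k + 1) ∈ c) :
    Reachable c (z, k + 1) := by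
  obtain ⟨w, hw⟩ := h
  exact ⟨none :: w, hc, Nat.succ_pos k, hw⟩

lemma Reachable.down {z : Fin n → ℤ} {k : ℕ} (e : Fin n × Bool)
    (h : Reachable c (z + signedUnit e, k + 1)) : Reachable c (z, k) := by
  obtain ⟨w, hw⟩ := h
  exact ⟨some e :: w, hw⟩

/-- Reachability spreads to other columns at the loss of one unit of height per unit of
`ℓ¹`-distance. -/
lemma Reachable.spread {z z' : Fin n → ℤ} {k : ℕ}
    (h : Reachable c (z', k + ∑ i, (z' i - z i).natAbs)) : Reachable c (z, k) := by
  generalize hd : ∑ i, (z' i - z i).natAbs = d at h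
  induction d generalizing z k with
  | zero =>
    have : z' = z := by
      ext i
      have := (Finset.sum_eq_zero_iff.1 hd) i (Finset.mem_univ i)
      omega
    rwa [this, add_zero] at h
  | succ d ih =>
    obtain ⟨i, hi⟩ : ∃ i, z' i ≠ z i := by
      by_contra hcon
      push Not at hcon
      simp [hcon] at hd
    -- Move one step from `z` towards `z'`.
    refine Reachable.down (i, decide (z i < z' i)) (ih (k := k + 1) ?_ ?_)
    · have h1 := Finset.add_sum_erase Finset.univ (fun j => (z' j - z j).natAbs) (Finset.mem_univ i)
      have h2 := Finset.add_sum_erase Finset.univ (fun j => (z' j - (z + signedUnit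
        (i, decide (z i < z' i))) j).natAbs) (Finset.mem_univ i)
      have h3 : ∑ j ∈ Finset.univ.erase i, (z' j - (z + signedUnit
          (i, decide (z i < z' i))) j).natAbs
          = ∑ j ∈ Finset.univ.erase i, (z' j - z j).natAbs := by
        refine Finset.sum_congr rfl fun j hj => ?_
        simp [signedUnit, Pi.single_eq_of_ne (Finset.ne_of_mem_erase hj)]
      have h4 : (z' i - (z + signedUnit (i, decide (z i < z' i))) i).natAbs + 1
          = (z' i - z i).natAbs := by
        simp only [signedUnit, Pi.add_apply, Pi.single_eq_same, decide_eq_true_eq]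
        split_ifs <;> omega
      rw [hd] at h1
      rw [← h2, h3]
      omega
    · rwa [add_assoc, add_comm 1 d]

/-- `p` is the site right above the highest reachable site of its column. -/
def IsSurface (c : Set (Site n)) (p : Site n) : Prop :=
  ∃ k, p.2 = k + 1 ∧ Reachable c (p.1, k) ∧ ∀ j, k < j → ¬ Reachable c (p.1, j)

lemma IsSurface.notMem {p : Site n} (h : IsSurface c p) : p ∉ c := by
  obtain ⟨k, hk, h1, h2⟩ := h
  intro hc
  refine h2 (k + 1) (Nat.lt_succ_self k) (h1.up ?_)
  rw [← hk]
  exact hc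

lemma exists_isSurface {z : Fin n → ℤ} (h : {k | Reachable c (z, k)}.Finite) :
    ∃ k, IsSurface c (z, k) := by
  obtain ⟨k, hk, hmax⟩ := h.exists_maximal ⟨0, reachable_zero z⟩
  refine ⟨k + 1, k, rfl, hk, fun j hj hr => ?_⟩
  exact absurd (hmax hr hj.le) (not_le.2 hj)

lemma IsSurface.height_le {p q : Site n} (hp : IsSurface c p) (hq : IsSurface c q) :
    p.2 ≤ q.2 + ∑ i, (p.1 i - q.1 i).natAbs := by
  obtain ⟨k, hk, h1, -⟩ := hp
  obtain ⟨j, hj, -, h2⟩ := hq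
  by_contra hcon
  push Not at hcon
  refine h2 (k - ∑ i, (p.1 i - q.1 i).natAbs) (by omega) (Reachable.spread (z' := p.1) ?_)
  rwa [Nat.sub_add_cancel (by omega)]

end

lemma tsum_list_pow_length_le {α : Type*} [Fintype α] {θ : ℝ≥0∞}
    (h : (Fintype.card α : ℝ≥0∞) * θ ≤ 2⁻¹) : ∑' w : List α, θ ^ w.length ≤ 2 := by
  have h1 : ∑' w : List α, θ ^ w.length = ∑' N : ℕ, ((Fintype.card α : ℝ≥0∞) * θ) ^ N := by
    rw [← (List.equivSigmaTuple (α := α)).symm.tsum_eq, ENNReal.tsum_sigma']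
    refine tsum_congr fun N => ?_
    simp [List.equivSigmaTuple, tsum_fintype, mul_pow]
  rw [h1]
  calc ∑' N : ℕ, ((Fintype.card α : ℝ≥0∞) * θ) ^ N ≤ ∑' N : ℕ, (2⁻¹ : ℝ≥0∞) ^ N :=
        ENNReal.tsum_le_tsum fun N => by gcongr
    _ = 2 := by simp [ENNReal.tsum_geometric]

section

variable {n : ℕ} {Ω : Type*} [MeasurableSpace Ω] {μ : Measure Ω} {c : Ω → Set (Site n)}

/-- Union bound over all shortest paths. A path with `N` moves to height `k` has `(N + k) / 2` moves
straight up, and there are `(2 n + 1) ^ N` words of length `N`. -/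
lemma measure_reachable_le {θ : ℝ≥0∞} (hθ : (2 * n + 1 : ℝ≥0∞) * θ ≤ 2⁻¹)
    (hc : ∀ S : Finset (Site n), μ {ω | ∀ p ∈ S, p ∈ c ω} ≤ (θ ^ 2) ^ S.card) (p : Site n) :
    μ {ω | Reachable (c ω) p} ≤ 2 * θ ^ p.2 := by
  classical
  have hsub : {ω | Reachable (c ω) p} ⊆ ⋃ w : List (Option (Fin n × Bool)),
      {ω | IsPathTo (c ω) w p ∧ (upSites w p).Nodup} := fun ω hω =>
    Set.mem_iUnion.2 (Reachable.exists_nodup hω)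
  have hw : ∀ w : List (Option (Fin n × Bool)),
      μ {ω | IsPathTo (c ω) w p ∧ (upSites w p).Nodup} ≤ θ ^ w.length * θ ^ p.2 := by
    intro w
    by_cases hex : ∃ ω, IsPathTo (c ω) w p ∧ (upSites w p).Nodup
    · obtain ⟨ω₀, h₀, hnd⟩ := hex
      rw [← pow_add, h₀.length_add_height, pow_mul, ← List.toFinset_card_of_nodup hnd]
      refine (measure_mono fun ω hω => ?_).trans (hc _)
      intro q hq
      exact hω.1.upSites_subset q (List.mem_toFinset.1 hq)
    · have : {ω | IsPathTo (c ω) w p ∧ (upSites w p).Nodup} = ∅ :=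
        Set.eq_empty_of_forall_notMem fun ω hω => hex ⟨ω, hω⟩
      rw [this, measure_empty]
      exact zero_le
  refine (measure_mono hsub).trans ((measure_iUnion_le _).trans
    ((ENNReal.tsum_le_tsum hw).trans ?_))
  rw [ENNReal.tsum_mul_right]
  gcongr
  refine tsum_list_pow_length_le ?_
  convert hθ using 2
  simp
  ring

lemma ae_finite_reachable {θ : ℝ≥0∞} (hθ : (2 * n + 1 : ℝ≥0∞) * θ ≤ 2⁻¹)
    (hc : ∀ S : Finset (Site n), μ {ω | ∀ p ∈ S, p ∈ c ω} ≤ (θ ^ 2) ^ S.card) :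
    ∀ᵐ ω ∂μ, ∀ z : Fin n → ℤ, {k | Reachable (c ω) (z, k)}.Finite := by
  rw [ae_all_iff]
  intro z
  refine ae_finite_setOfPred_mem (s := fun k => {ω | Reachable (c ω) (z, k)}) ?_
  have hθ' : θ ≤ 2⁻¹ := by
    refine le_trans ?_ hθ
    exact le_mul_of_one_le_left zero_le (by simp)
  refine ne_top_of_le_ne_top (b := 4) (by simp) ?_
  calc ∑' k : ℕ, μ {ω | Reachable (c ω) (z, k)} ≤ ∑' k : ℕ, 2 * (2⁻¹ : ℝ≥0∞) ^ k :=
        ENNReal.tsum_le_tsum fun k => (measure_reachable_le hθ hc (z, k)).trans (by gcongr)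
    _ = 4 := by
      rw [ENNReal.tsum_mul_left, ENNReal.tsum_geometric, ENNReal.one_sub_inv_two, inv_inv]
      norm_num

lemma measurableSet_reachable (hc : ∀ p, MeasurableSet {ω | p ∈ c ω}) (p : Site n) :
    MeasurableSet {ω | Reachable (c ω) p} := by
  have hpath : ∀ (w : List (Option (Fin n × Bool))) (p : Site n),
      MeasurableSet {ω | IsPathTo (c ω) w p} := by
    intro w
    induction w with
    | nil => intro p; exact MeasurableSet.const _
    | cons m w ih =>
      intro p
      cases m with
      | none => exact (hc p).inter ((MeasurableSet.const _).inter (ih _))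
      | some e => exact ih _
  have : {ω | Reachable (c ω) p} = ⋃ w, {ω | IsPathTo (c ω) w p} := by
    ext ω; simp [Reachable]
  rw [this]
  exact MeasurableSet.iUnion fun w => hpath w p

lemma measurableSet_isSurface (hc : ∀ p, MeasurableSet {ω | p ∈ c ω}) (p : Site n) :
    MeasurableSet {ω | IsSurface (c ω) p} := by
  have : {ω | IsSurface (c ω) p} = ⋃ k : ℕ, {_ω | p.2 = k + 1} ∩ ({ω | Reachable (c ω) (p.1, k)} ∩
      ⋂ j : ℕ, {ω | k < j → ¬ Reachable (c ω) (p.1, j)}) := by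
    ext ω; simp [IsSurface]
  rw [this]
  refine MeasurableSet.iUnion fun k => (MeasurableSet.const _).inter
    ((measurableSet_reachable hc _).inter (MeasurableSet.iInter fun j => ?_))
  by_cases hkj : k < j
  · simpa [hkj, Set.compl_ofPred] using (measurableSet_reachable hc (p.1, j)).compl
  · simp [hkj]

end

/-! ### Poisson points with strengths -/

lemma setOf_pointCount_eq {Ω S : Type*} {P : ℕ → Ω → S} (A : Set S) (m : ℕ) :
    {ω | pointCount P A ω = m}
      = ⋃ I : {I : Finset ℕ // I.card = m}, {ω | {k | P k ω ∈ A} = ((I : Finset ℕ) : Set ℕ)} := by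
  ext ω
  simp only [pointCount, Set.mem_iUnion, Set.mem_ofPred_eq]
  constructor
  · intro h
    have hfin : {k | P k ω ∈ A}.Finite := Set.finite_of_encard_eq_coe h
    refine ⟨⟨hfin.toFinset, ?_⟩, by simp⟩
    rw [hfin.encard_eq_coe_toFinset_card] at h
    exact_mod_cast h
  · rintro ⟨⟨I, hI⟩, h⟩
    rw [h, Set.encard_coe_eq_coe_finsetCard, hI]

section

variable {Ω : Type*} [MeasurableSpace Ω] {μ : Measure Ω} {n : ℕ} {D A : Set (Ambient n)}
  {lam : ℝ≥0} {P : ℕ → Ω → Ambient n}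

lemma measurableSet_index_eq (hP : ∀ k, Measurable (P k)) (hA : MeasurableSet A) (I : Set ℕ) :
    MeasurableSet {ω | {k | P k ω ∈ A} = I} := by
  have : {ω | {k | P k ω ∈ A} = I} = ⋂ k, {ω | P k ω ∈ A ↔ k ∈ I} := by
    ext ω
    simp [Set.ext_iff]
  rw [this]
  refine MeasurableSet.iInter fun k => ?_
  by_cases hk : k ∈ I
  · have : {ω | P k ω ∈ A ↔ k ∈ I} = P k ⁻¹' A := by ext; simp [hk]
    rw [this]
    exact hP k hA
  · have : {ω | P k ω ∈ A ↔ k ∈ I} = (P k ⁻¹' A)ᶜ := by ext; simp [hk]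
    rw [this]
    exact (hP k hA).compl

lemma measurableSet_pointCount_eq (hP : ∀ k, Measurable (P k)) (hA : MeasurableSet A) (m : ℕ) :
    MeasurableSet {ω | pointCount P A ω = m} := by
  rw [setOf_pointCount_eq]
  exact MeasurableSet.iUnion fun I => measurableSet_index_eq hP hA _

lemma tsum_poissonMeasure_singleton (r : ℝ≥0) : ∑' m : ℕ, poissonMeasure r {m} = 1 := by
  simp_rw [poissonMeasure_singleton]
  rw [← ENNReal.ofReal_tsum_of_nonneg (fun m => by positivity) (hasSum_one_poissonMeasure r).summable,
    (hasSum_one_poissonMeasure r).tsum_eq, ENNReal.ofReal_one]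

lemma IsPoissonProcess.ae_finite [IsProbabilityMeasure μ] (h : IsPoissonProcess μ D lam P)
    (hA : MeasurableSet A) (hAD : A ⊆ D) (hvol : volume A ≠ ∞) :
    ∀ᵐ ω ∂μ, {k | P k ω ∈ A}.Finite := by
  have hm := fun m => measurableSet_pointCount_eq h.measurable hA m
  have h1 : μ (⋃ m : ℕ, {ω | pointCount P A ω = m}) = 1 := by
    rw [measure_iUnion _ hm, ← tsum_poissonMeasure_singleton (lam * (volume A).toNNReal)]
    · exact tsum_congr fun m => h.law A hA hAD hvol m
    · intro i j hij
      refine Set.disjoint_left.2 fun ω hi hj => hij ?_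
      have : (i : ℕ∞) = j := (Eq.symm hi).trans hj
      exact_mod_cast this
  have h2 := (prob_compl_eq_zero_iff (MeasurableSet.iUnion hm)).2 h1
  rw [ae_iff]
  refine measure_mono_null (fun ω hω => ?_) h2
  intro hmem
  obtain ⟨m, hm⟩ := Set.mem_iUnion.1 hmem
  exact hω (Set.finite_of_encard_eq_coe hm)

end

section

variable {Ω : Type*} [MeasurableSpace Ω] {μ : Measure Ω} {n : ℕ}
  {A : Set (Ambient n)} {r₁ : ℝ} {lam : ℝ≥0} {P : ℕ → Ω → Ambient n} {s : ℕ → Ω → ℝ}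

lemma IsObstacleDistribution.measure_forall_strength_lt
    (h : IsObstacleDistribution μ r₁ lam P s) (c : ℝ) (I : Finset ℕ) :
    μ {ω | ∀ k ∈ I, s k ω < c} = μ {ω | s 0 ω < c} ^ I.card := by
  have h1 := h.strength_indep.measure_inter_preimage_eq_mul I (sets := fun _ => Set.Iio c)
    (fun _ _ => measurableSet_Iio)
  have h2 : {ω | ∀ k ∈ I, s k ω < c} = ⋂ k ∈ I, s k ⁻¹' Set.Iio c := by
    ext ω; simp
  rw [h2, h1]
  exact Finset.prod_eq_pow_card fun k _ =>
    (h.strength_identDistrib k).measure_mem_eq measurableSet_Iio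

/-- Thinning: given that `A` contains `m` points, these are all weak with probability `πᵐ`. -/
lemma IsObstacleDistribution.measure_weak_inter_le (h : IsObstacleDistribution μ r₁ lam P s)
    (hA : MeasurableSet A) (c : ℝ) (m : ℕ) :
    μ ({ω | ∀ k, P k ω ∈ A → s k ω < c} ∩ {ω | pointCount P A ω = m})
      ≤ μ {ω | s 0 ω < c} ^ m * μ {ω | pointCount P A ω = m} := by
  have hmeas := fun I : Finset ℕ => measurableSet_index_eq h.poisson.measurable hA (I : Set ℕ)
  have hind : ∀ I : Finset ℕ, μ ({ω | ∀ k ∈ I, s k ω < c} ∩ {ω | {k | P k ω ∈ A} = (I : Set ℕ)})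
      = μ {ω | s 0 ω < c} ^ I.card * μ {ω | {k | P k ω ∈ A} = (I : Set ℕ)} := by
    intro I
    rw [← h.measure_forall_strength_lt]
    have hs : MeasurableSet {a : ℕ → ℝ | ∀ k ∈ I, a k < c} := by
      have : {a : ℕ → ℝ | ∀ k ∈ I, a k < c} = ⋂ k ∈ I, {a | a k < c} := by ext; simp
      rw [this]
      exact Finset.measurableSet_biInter _ fun k _ =>
        measurableSet_lt (measurable_pi_apply k) measurable_const
    have hp : MeasurableSet {a : ℕ → Ambient n | {k | a k ∈ A} = (I : Set ℕ)} :=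
      measurableSet_index_eq (P := fun k (a : ℕ → Ambient n) => a k)
        (fun k => measurable_pi_apply k) hA _
    exact h.indep_centres.measure_inter_preimage_eq_mul _ _ hs hp
  have hsub : {ω | ∀ k, P k ω ∈ A → s k ω < c} ∩ {ω | pointCount P A ω = m}
      ⊆ ⋃ I : {I : Finset ℕ // I.card = m},
        {ω | ∀ k ∈ (I : Finset ℕ), s k ω < c} ∩ {ω | {k | P k ω ∈ A} = ((I : Finset ℕ) : Set ℕ)} := by
    rintro ω ⟨hω, hm⟩
    rw [setOf_pointCount_eq] at hm
    obtain ⟨I, hI⟩ := Set.mem_iUnion.1 hm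
    refine Set.mem_iUnion.2 ⟨I, fun k hk => hω k ?_, hI⟩
    have : k ∈ {k | P k ω ∈ A} := by
      rw [show {k | P k ω ∈ A} = ((I : Finset ℕ) : Set ℕ) from hI]; exact hk
    exact this
  refine (measure_mono hsub).trans ((measure_iUnion_le _).trans ?_)
  have hterm : ∀ I : {I : Finset ℕ // I.card = m},
      μ ({ω | ∀ k ∈ (I : Finset ℕ), s k ω < c} ∩ {ω | {k | P k ω ∈ A} = ((I : Finset ℕ) : Set ℕ)})
      = μ {ω | s 0 ω < c} ^ m * μ {ω | {k | P k ω ∈ A} = ((I : Finset ℕ) : Set ℕ)} := fun I => by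
    rw [hind, I.2]
  simp_rw [hterm]
  rw [ENNReal.tsum_mul_left, setOf_pointCount_eq, measure_iUnion _ fun I => hmeas _]
  intro I J hIJ
  refine Set.disjoint_left.2 fun ω hI hJ => hIJ ?_
  have : ((I : Finset ℕ) : Set ℕ) = ((J : Finset ℕ) : Set ℕ) := (Eq.symm hI).trans hJ
  exact Subtype.ext (Finset.coe_injective this)

/-- A bound for the probability `exp (-(1 - π) Λ)` that all points in `A` are weak, where `Λ` is the mean number of
points and `π ≤ 1 / 2` the probability of being weak. -/
lemma IsObstacleDistribution.measure_weak_le [IsProbabilityMeasure μ]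
    (h : IsObstacleDistribution μ r₁ lam P s)
    (hA : MeasurableSet A) (hAD : A ⊆ {p | r₁ ≤ p.2}) (hvol : volume A ≠ ∞) {c : ℝ}
    (hc : μ {ω | s 0 ω < c} ≤ 2⁻¹) :
    μ {ω | ∀ k, P k ω ∈ A → s k ω < c}
      ≤ ENNReal.ofReal (Real.exp (-(lam * (volume A).toReal / 2))) := by
  set Λ : ℝ≥0 := lam * (volume A).toNNReal with hΛ
  have hΛr : (lam : ℝ) * (volume A).toReal = Λ := by rw [hΛ]; push_cast; rfl
  have hsub : {ω | ∀ k, P k ω ∈ A → s k ω < c}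
      ≤ᵐ[μ] ⋃ m : ℕ, {ω | ∀ k, P k ω ∈ A → s k ω < c} ∩ {ω | pointCount P A ω = m} := by
    filter_upwards [h.poisson.ae_finite hA hAD hvol] with ω hfin hω
    exact Set.mem_iUnion.2 ⟨_, hω, hfin.encard_eq_coe_toFinset_card⟩
  refine (measure_mono_ae hsub).trans ((measure_iUnion_le _).trans ?_)
  have hterm : ∀ m : ℕ, μ ({ω | ∀ k, P k ω ∈ A → s k ω < c} ∩ {ω | pointCount P A ω = m})
      ≤ ENNReal.ofReal (Real.exp (-(lam * (volume A).toReal / 2))) * poissonMeasure (Λ / 2) {m} := by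
    intro m
    refine (h.measure_weak_inter_le hA c m).trans ?_
    rw [h.poisson.law A hA hAD hvol m, poissonMeasure_singleton, poissonMeasure_singleton,
      ← ENNReal.ofReal_mul (Real.exp_pos _).le, hΛr]
    calc μ {ω | s 0 ω < c} ^ m * ENNReal.ofReal (Real.exp (-(Λ : ℝ)) * Λ ^ m / m.factorial)
        ≤ 2⁻¹ ^ m * ENNReal.ofReal (Real.exp (-(Λ : ℝ)) * Λ ^ m / m.factorial) := by gcongr
      _ = ENNReal.ofReal ((2⁻¹) ^ m * (Real.exp (-(Λ : ℝ)) * Λ ^ m / m.factorial)) := by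
        rw [ENNReal.ofReal_mul (by positivity), ENNReal.ofReal_pow (by positivity),
          ENNReal.ofReal_inv_of_pos two_pos, ENNReal.ofReal_ofNat]
      _ = _ := by
        congr 1
        have : Real.exp (-(Λ : ℝ)) = Real.exp (-(Λ / 2)) * Real.exp (-(Λ / 2)) := by
          rw [← Real.exp_add]; ring_nf
        rw [this]
        push_cast
        rw [div_pow, inv_pow]
        ring
  refine (ENNReal.tsum_le_tsum hterm).trans ?_
  rw [ENNReal.tsum_mul_left, tsum_poissonMeasure_singleton, mul_one]

lemma IsObstacleDistribution.exists_strength_lt_le [IsProbabilityMeasure μ]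
    (h : IsObstacleDistribution μ r₁ lam P s) :
    ∃ c : ℝ, 0 < c ∧ μ {ω | s 0 ω < c} ≤ 2⁻¹ := by
  have hanti : Antitone fun j : ℕ => {ω | s 0 ω < 1 / ((j : ℝ) + 1)} := by
    intro i j hij ω hω
    exact lt_of_lt_of_le (show s 0 ω < _ from hω) (Nat.one_div_le_one_div hij)
  have hlim := tendsto_measure_iInter_atTop (μ := μ) (s := fun j : ℕ => {ω | s 0 ω < 1 / ((j : ℝ) + 1)})
    (fun j => (measurableSet_lt (h.strength_measurable 0) measurable_const).nullMeasurableSet) hanti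
    ⟨0, measure_ne_top _ _⟩
  have h0 : μ (⋂ j : ℕ, {ω | s 0 ω < 1 / ((j : ℝ) + 1)}) = 0 := by
    refine measure_mono_null (fun ω hω => ?_) (ae_iff.1 (h.strength_pos 0))
    intro hpos
    obtain ⟨j, hj⟩ := exists_nat_one_div_lt hpos
    exact absurd (Set.mem_iInter.1 hω j) (not_lt.2 hj.le)
  rw [h0] at hlim
  obtain ⟨j, hj⟩ := (hlim.eventually (gt_mem_nhds (show (0 : ℝ≥0∞) < 2⁻¹ by simp))).exists
  exact ⟨1 / ((j : ℝ) + 1), by positivity, hj.le⟩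

end

/-! ### Boxes -/

/-- The box of the space `ℝⁿ × [r₁, ∞)` that belongs to a site: a cube of side `ℓ` times an interval
of length `hgt`. -/
def box {n : ℕ} (r₁ ℓ hgt : ℝ) (p : Site n) : Set (Ambient n) :=
  {q | ∀ i, q.1 i ∈ Set.Ico (ℓ * p.1 i) (ℓ * (p.1 i + 1))} ∩
    {q | q.2 ∈ Set.Ico (r₁ + hgt * p.2) (r₁ + hgt * (p.2 + 1))}

section

variable {n : ℕ} {r₁ ℓ hgt : ℝ}

lemma box_eq_prod (p : Site n) : box r₁ ℓ hgt p
    = (WithLp.ofLp ⁻¹' Set.univ.pi fun i => Set.Ico (ℓ * p.1 i) (ℓ * (p.1 i + 1)))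
      ×ˢ Set.Ico (r₁ + hgt * p.2) (r₁ + hgt * (p.2 + 1)) := by
  ext q
  simp [box, Set.mem_pi]

lemma measurableSet_box (p : Site n) : MeasurableSet (box r₁ ℓ hgt p) := by
  rw [box_eq_prod]
  exact ((PiLp.volume_preserving_ofLp (Fin n)).measurable
    (MeasurableSet.univ_pi fun i => measurableSet_Ico)).prod measurableSet_Ico

lemma volume_box (hℓ : 0 < ℓ) (p : Site n) :
    volume (box r₁ ℓ hgt p) = ENNReal.ofReal (ℓ ^ n * hgt) := by
  rw [box_eq_prod, Measure.volume_eq_prod, Measure.prod_prod,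
    (PiLp.volume_preserving_ofLp (Fin n)).measure_preimage
      (MeasurableSet.univ_pi fun i => measurableSet_Ico).nullMeasurableSet, volume_pi_pi,
    Real.volume_Ico, ENNReal.ofReal_mul (by positivity), ENNReal.ofReal_pow hℓ.le]
  congr 1
  · simp_rw [Real.volume_Ico]
    rw [Finset.prod_eq_pow_card (b := ENNReal.ofReal ℓ) (fun i _ => by congr 1; ring)]
    simp
  · congr 1; ring

lemma disjoint_box (hℓ : 0 < ℓ) (hh : 0 < hgt) {p q : Site n} (hpq : p ≠ q) :
    Disjoint (box r₁ ℓ hgt p) (box r₁ ℓ hgt q) := by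
  refine Set.disjoint_left.2 fun x hp hq => hpq ?_
  have key : ∀ {a t : ℝ}, 0 < a → ∀ {i j : ℤ}, a * i ≤ t → t < a * (j + 1) → i ≤ j := by
    intro a t ha i j h1 h2
    have h3 := lt_of_mul_lt_mul_left (h1.trans_lt h2) ha.le
    have : i < j + 1 := by exact_mod_cast h3
    omega
  refine Prod.ext (funext fun i => le_antisymm ?_ ?_) (Nat.le_antisymm ?_ ?_)
  · exact key hℓ (hp.1 i).1 (hq.1 i).2
  · exact key hℓ (hq.1 i).1 (hp.1 i).2
  · have := key (t := x.2 - r₁) hh (i := p.2) (j := q.2)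
      (by push_cast; linarith [hp.2.1]) (by push_cast; linarith [hq.2.2])
    exact_mod_cast this
  · have := key (t := x.2 - r₁) hh (i := q.2) (j := p.2)
      (by push_cast; linarith [hq.2.1]) (by push_cast; linarith [hp.2.2])
    exact_mod_cast this

lemma box_subset (hh : 0 < hgt) (p : Site n) : box r₁ ℓ hgt p ⊆ {q | r₁ ≤ q.2} := by
  intro q hq
  have := hq.2.1
  have h2 : 0 ≤ hgt * p.2 := by positivity
  simp only [Set.mem_ofPred_eq]
  linarith

end

/-- The sites whose box contains no point of strength at least `c`. -/
def closedSites {Ω : Type*} {n : ℕ} (P : ℕ → Ω → Ambient n) (s : ℕ → Ω → ℝ) (r₁ ℓ hgt c : ℝ)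
    (ω : Ω) : Set (Site n) :=
  {p | ∀ k, P k ω ∈ box r₁ ℓ hgt p → s k ω < c}

section

variable {Ω : Type*} [MeasurableSpace Ω] {μ : Measure Ω} {n : ℕ}
  {r₁ ℓ hgt c : ℝ} {lam : ℝ≥0} {P : ℕ → Ω → Ambient n} {s : ℕ → Ω → ℝ}

lemma IsObstacleDistribution.measurableSet_mem_closedSites
    (h : IsObstacleDistribution μ r₁ lam P s) (p : Site n) :
    MeasurableSet {ω | p ∈ closedSites P s r₁ ℓ hgt c ω} := by
  have : {ω | p ∈ closedSites P s r₁ ℓ hgt c ω}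
      = ⋂ k, ((P k ⁻¹' box r₁ ℓ hgt p)ᶜ ∪ {ω | s k ω < c}) := by
    ext ω
    simp [closedSites, imp_iff_not_or]
  rw [this]
  exact MeasurableSet.iInter fun k => ((h.poisson.measurable k) (measurableSet_box p)).compl.union
    (measurableSet_lt (h.strength_measurable k) measurable_const)

lemma IsObstacleDistribution.measure_forall_mem_closedSites_le [IsProbabilityMeasure μ]
    (h : IsObstacleDistribution μ r₁ lam P s) (hℓ : 0 < ℓ) (hh : 0 < hgt)
    (hc : μ {ω | s 0 ω < c} ≤ 2⁻¹) (S : Finset (Site n)) :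
    μ {ω | ∀ p ∈ S, p ∈ closedSites P s r₁ ℓ hgt c ω}
      ≤ (ENNReal.ofReal (Real.exp (-(lam * (ℓ ^ n * hgt) / 4))) ^ 2) ^ S.card := by
  have hvol : volume (⋃ p ∈ S, box r₁ ℓ hgt p) = S.card * ENNReal.ofReal (ℓ ^ n * hgt) := by
    rw [measure_biUnion_finset (fun p _ q _ hpq => disjoint_box hℓ hh hpq)
      fun p _ => measurableSet_box p, Finset.sum_congr rfl fun p _ => volume_box hℓ p]
    simp
  have h1 : {ω | ∀ p ∈ S, p ∈ closedSites P s r₁ ℓ hgt c ω}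
      = {ω | ∀ k, P k ω ∈ (⋃ p ∈ S, box r₁ ℓ hgt p) → s k ω < c} := by
    ext ω
    simp only [closedSites, Set.mem_ofPred_eq, Set.mem_iUnion, exists_prop]
    exact ⟨fun H k ⟨p, hp, hk⟩ => H p hp k hk, fun H p hp k hk => H k ⟨p, hp, hk⟩⟩
  rw [h1]
  refine (h.measure_weak_le (Finset.measurableSet_biUnion _ fun p _ => measurableSet_box p)
    (Set.iUnion₂_subset fun p _ => box_subset hh p) ?_ hc).trans (le_of_eq ?_)
  · rw [hvol]
    exact ENNReal.mul_ne_top (ENNReal.natCast_ne_top _) ENNReal.ofReal_ne_top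
  · rw [hvol, ENNReal.toReal_mul, ENNReal.toReal_natCast, ENNReal.toReal_ofReal (by positivity),
      ← pow_mul, ← ENNReal.ofReal_pow (Real.exp_pos _).le, ← Real.exp_nat_mul]
    congr 2
    push_cast
    ring

lemma IsObstacleDistribution.ae_finite_reachable [IsProbabilityMeasure μ]
    (h : IsObstacleDistribution μ r₁ lam P s)
    (hℓ : 0 < ℓ) (hh : 0 < hgt) (hc : μ {ω | s 0 ω < c} ≤ 2⁻¹)
    (hlarge : Real.log (2 * (2 * n + 1)) ≤ lam * (ℓ ^ n * hgt) / 4) :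
    ∀ᵐ ω ∂μ, ∀ z : Fin n → ℤ, {k | Reachable (closedSites P s r₁ ℓ hgt c ω) (z, k)}.Finite := by
  refine QEW.ae_finite_reachable (θ := ENNReal.ofReal (Real.exp (-(lam * (ℓ ^ n * hgt) / 4)))) ?_
    (h.measure_forall_mem_closedSites_le hℓ hh hc)
  have h1 : Real.exp (-(lam * (ℓ ^ n * hgt) / 4)) ≤ (2 * (2 * (n : ℝ) + 1))⁻¹ := by
    rw [Real.exp_neg]
    refine inv_anti₀ (by positivity) ?_
    rwa [← Real.log_le_iff_le_exp (by positivity)]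
  have h2 : (2 * n + 1 : ℝ≥0∞) = ENNReal.ofReal (2 * n + 1) := by
    rw [ENNReal.ofReal_add (by positivity) zero_le_one, ENNReal.ofReal_mul zero_le_two]
    simp
  have h3 : (2⁻¹ : ℝ≥0∞) = ENNReal.ofReal 2⁻¹ := by
    rw [ENNReal.ofReal_inv_of_pos two_pos, ENNReal.ofReal_ofNat]
  rw [h2, h3, ← ENNReal.ofReal_mul (by positivity)]
  refine ENNReal.ofReal_le_ofReal ?_
  calc (2 * n + 1 : ℝ) * Real.exp (-(lam * (ℓ ^ n * hgt) / 4))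
      ≤ (2 * n + 1) * (2 * (2 * (n : ℝ) + 1))⁻¹ := by gcongr
    _ = 2⁻¹ := by field_simp

end

/-! ### The obstacle field of a locally finite configuration -/

section

variable {Ω : Type*} {n : ℕ} {r₀ r₁ : ℝ} {φ : Ambient n → ℝ} {P : ℕ → Ω → Ambient n}
  {s : ℕ → Ω → ℝ} {ω : Ω}

lemma IsObstacleShape.norm_le_of_ne_zero (hφ : IsObstacleShape n r₀ r₁ φ) {p : Ambient n}
    (hp : φ p ≠ 0) : ‖p‖ ≤ r₁ := by
  have h : √(‖p.1‖ ^ 2 + p.2 ^ 2) ≤ r₁ := by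
    by_contra hcon
    exact hp (hφ.eq_zero p (not_le.1 hcon))
  rw [Prod.norm_def]
  refine max_le (le_trans ?_ h) (le_trans ?_ h)
  · exact Real.le_sqrt_of_sq_le (by nlinarith [sq_nonneg p.2])
  · exact Real.le_sqrt_of_sq_le (by rw [Real.norm_eq_abs, sq_abs]; nlinarith [sq_nonneg ‖p.1‖])

lemma IsObstacleShape.finite_near (hφ : IsObstacleShape n r₀ r₁ φ)
    (hfin : ∀ R : ℕ, {k | ‖P k ω‖ ≤ R}.Finite) (R : ℝ) :
    {k | ∃ q : Ambient n, ‖q‖ ≤ R ∧ s k ω * φ (q - P k ω) ≠ 0}.Finite := by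
  obtain ⟨N, hN⟩ := exists_nat_ge (R + r₁)
  refine (hfin N).subset ?_
  rintro k ⟨q, hq, hne⟩
  have h1 := hφ.norm_le_of_ne_zero (right_ne_zero_of_mul hne)
  have h2 : P k ω = q - (q - P k ω) := by abel
  have h3 := norm_sub_le q (q - P k ω)
  rw [← h2] at h3
  exact h3.trans (by linarith)

lemma IsObstacleShape.finite_support (hφ : IsObstacleShape n r₀ r₁ φ)
    (hfin : ∀ R : ℕ, {k | ‖P k ω‖ ≤ R}.Finite) (q : Ambient n) :
    (Function.support fun k => s k ω * φ (q - P k ω)).Finite :=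
  (hφ.finite_near hfin ‖q‖).subset fun _ hk => ⟨q, le_rfl, hk⟩

lemma IsObstacleShape.continuous_field (hφ : IsObstacleShape n r₀ r₁ φ)
    (hfin : ∀ R : ℕ, {k | ‖P k ω‖ ≤ R}.Finite) :
    Continuous fun q : Ambient n => obstacleField φ P s ω q.1 q.2 := by
  have h1 : (fun q : Ambient n => obstacleField φ P s ω q.1 q.2)
      = fun q => ∑ᶠ k, s k ω * φ (q - P k ω) := by
    ext q
    exact tsum_eq_finsum (hφ.finite_support hfin q)
  rw [h1]
  refine continuous_finsum (fun k => continuous_const.mul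
    (hφ.smooth.continuous.comp (continuous_id.sub continuous_const))) fun q => ?_
  refine ⟨Metric.ball q 1, Metric.ball_mem_nhds q one_pos,
    (hφ.finite_near (s := s) hfin (‖q‖ + 1)).subset ?_⟩
  rintro k ⟨q', hq', hball⟩
  refine ⟨q', ?_, hq'⟩
  have h2 := norm_le_norm_add_norm_sub' q' q
  rw [← dist_eq_norm] at h2
  linarith [Metric.mem_ball.1 hball]

lemma IsObstacleShape.field_le_term (hφ : IsObstacleShape n r₀ r₁ φ)
    (hfin : ∀ R : ℕ, {k | ‖P k ω‖ ≤ R}.Finite) (hs : ∀ k, 0 < s k ω) (x : Base n) (y : ℝ)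
    (k : ℕ) : obstacleField φ P s ω x y ≤ s k ω * φ ((x, y) - P k ω) := by
  have hsum : Summable fun k => -(s k ω * φ ((x, y) - P k ω)) :=
    (summable_of_hasFiniteSupport (hφ.finite_support hfin (x, y))).neg
  have h := hsum.le_tsum k fun j _ => by
    have := mul_nonpos_of_nonneg_of_nonpos (hs j).le (hφ.nonpos ((x, y) - P j ω))
    linarith
  rw [tsum_neg] at h
  exact neg_le_neg_iff.1 h

lemma IsObstacleShape.field_nonpos (hφ : IsObstacleShape n r₀ r₁ φ) (hs : ∀ k, 0 < s k ω)
    (x : Base n) (y : ℝ) : obstacleField φ P s ω x y ≤ 0 :=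
  tsum_nonpos fun k => mul_nonpos_of_nonneg_of_nonpos (hs k).le (hφ.nonpos _)

end

/-! ### The obstacles on the percolating surface -/

lemma norm_le_of_abs_apply_le {n : ℕ} (hn : 1 ≤ n) {ℓ : ℝ} (hℓ : 0 ≤ ℓ) {x : Base n}
    (h : ∀ i, |x i| ≤ ℓ) : ‖x‖ ≤ n * ℓ := by
  have hn1 : (1 : ℝ) ≤ n := by exact_mod_cast hn
  refine abs_le_of_sq_le_sq' ?_ (by positivity) |>.2
  rw [EuclideanSpace.norm_sq_eq]
  calc ∑ i, ‖x i‖ ^ 2 ≤ ∑ _i : Fin n, ℓ ^ 2 := Finset.sum_le_sum fun i _ => by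
        rw [Real.norm_eq_abs]; have := h i; gcongr
    _ = n * ℓ ^ 2 := by simp
    _ ≤ (n * ℓ) ^ 2 := by rw [mul_pow]; gcongr; nlinarith

/-- The indices of the points of strength at least `c` in the boxes of the percolating surface. -/
def surfaceIndices {Ω : Type*} {n : ℕ} (P : ℕ → Ω → Ambient n) (s : ℕ → Ω → ℝ) (r₁ ℓ hgt c : ℝ)
    (ω : Ω) : Set ℕ :=
  {k | c ≤ s k ω ∧
    ∃ p : Site n, P k ω ∈ box r₁ ℓ hgt p ∧ IsSurface (closedSites P s r₁ ℓ hgt c ω) p}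

section

variable {Ω : Type*} {n : ℕ} {r₁ ℓ hgt c : ℝ} {P : ℕ → Ω → Ambient n} {s : ℕ → Ω → ℝ} {ω : Ω}

lemma exists_mem_surfaceIndices (hn : 1 ≤ n) (hℓ : 0 < ℓ)
    (hfin : ∀ z : Fin n → ℤ, {k | Reachable (closedSites P s r₁ ℓ hgt c ω) (z, k)}.Finite)
    (x : Base n) : ∃ k ∈ surfaceIndices P s r₁ ℓ hgt c ω, ‖x - (P k ω).1‖ ≤ n * ℓ := by
  obtain ⟨j, hj⟩ := exists_isSurface (hfin fun i => ⌊x i / ℓ⌋)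
  have hopen := hj.notMem
  simp only [closedSites, Set.mem_ofPred_eq, not_forall, not_lt] at hopen
  obtain ⟨k, hk, hck⟩ := hopen
  refine ⟨k, ⟨hck, _, hk, hj⟩, norm_le_of_abs_apply_le hn hℓ.le fun i => ?_⟩
  have h1 := (hk.1 i).1
  have h2 := (hk.1 i).2
  have h3 := mul_le_mul_of_nonneg_left (Int.floor_le (x i / ℓ)) hℓ.le
  have h4 := mul_lt_mul_of_pos_left (Int.lt_floor_add_one (x i / ℓ)) hℓ
  rw [mul_div_cancel₀ _ hℓ.ne'] at h3 h4
  simp only at h1 h2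
  rw [PiLp.sub_apply, abs_le]
  constructor <;> linarith

lemma surfaceIndices_height_sub_le (hℓ : 0 < ℓ) (hh : 0 < hgt) {k k' : ℕ}
    (hk : k ∈ surfaceIndices P s r₁ ℓ hgt c ω) (hk' : k' ∈ surfaceIndices P s r₁ ℓ hgt c ω) :
    (P k ω).2 - (P k' ω).2 ≤ hgt * (n * ‖(P k ω).1 - (P k' ω).1‖ / ℓ + n + 1) := by
  obtain ⟨-, p, hp, hpS⟩ := hk
  obtain ⟨-, p', hp', hpS'⟩ := hk'
  set d := ‖(P k ω).1 - (P k' ω).1‖ with hd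
  have h1 : (p.2 : ℝ) ≤ p'.2 + ∑ i, ((p.1 i - p'.1 i).natAbs : ℝ) := by
    exact_mod_cast hpS.height_le hpS'
  have h2 : ∀ i, ((p.1 i - p'.1 i).natAbs : ℝ) ≤ d / ℓ + 1 := by
    intro i
    have h3 : |(P k ω).1 i - (P k' ω).1 i| ≤ d := by
      have := PiLp.norm_apply_le ((P k ω).1 - (P k' ω).1) i
      rwa [Real.norm_eq_abs, PiLp.sub_apply] at this
    have h4 := abs_le.1 h3
    have a1 := hp.1 i
    have a2 := hp'.1 i
    rw [Nat.cast_natAbs, Int.cast_abs, Int.cast_sub, ← sub_le_iff_le_add, le_div_iff₀ hℓ]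
    rcases abs_cases ((p.1 i : ℝ) - p'.1 i) with ⟨e, -⟩ | ⟨e, -⟩ <;> rw [e] <;>
      linarith [a1.1, a1.2, a2.1, a2.2]
  have h5 : ∑ i, ((p.1 i - p'.1 i).natAbs : ℝ) ≤ n * (d / ℓ + 1) := by
    refine (Finset.sum_le_sum fun i _ => h2 i).trans (le_of_eq ?_)
    simp [mul_add]
  have h6 : hgt * (p.2 - p'.2 + 1) ≤ hgt * (n * d / ℓ + n + 1) := by
    gcongr
    have : (n : ℝ) * (d / ℓ + 1) = n * d / ℓ + n := by ring
    linarith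
  linarith [hp.2.2, hp'.2.1]

lemma IsObstacleDistribution.measurableSet_mem_surfaceIndices [MeasurableSpace Ω] {μ : Measure Ω}
    {lam : ℝ≥0} (h : IsObstacleDistribution μ r₁ lam P s) (k : ℕ) :
    MeasurableSet {ω | k ∈ surfaceIndices P s r₁ ℓ hgt c ω} := by
  have : {ω | k ∈ surfaceIndices P s r₁ ℓ hgt c ω} = {ω | c ≤ s k ω} ∩ ⋃ p : Site n,
      (P k ⁻¹' box r₁ ℓ hgt p ∩ {ω | IsSurface (closedSites P s r₁ ℓ hgt c ω) p}) := by
    ext ω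
    simp [surfaceIndices]
  rw [this]
  exact (measurableSet_le measurable_const (h.strength_measurable k)).inter
    (MeasurableSet.iUnion fun p => ((h.poisson.measurable k) (measurableSet_box p)).inter
      (measurableSet_isSurface h.measurableSet_mem_closedSites p))

lemma IsObstacleDistribution.ae_locallyFinite [MeasurableSpace Ω] {μ : Measure Ω}
    [IsProbabilityMeasure μ] {lam : ℝ≥0} (h : IsObstacleDistribution μ r₁ lam P s) :
    ∀ᵐ ω ∂μ, ∀ R : ℕ, {k | ‖P k ω‖ ≤ R}.Finite := by
  rw [ae_all_iff]
  intro R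
  have hD : MeasurableSet {p : Ambient n | r₁ ≤ p.2} :=
    measurableSet_le measurable_const measurable_snd
  have h1 := h.poisson.ae_finite (hD.inter (Metric.isClosed_closedBall (x := (0 : Ambient n))
    (ε := R)).measurableSet) Set.inter_subset_left
    (ne_top_of_le_ne_top (Metric.isBounded_closedBall (x := (0 : Ambient n))
      (r := R)).measure_lt_top.ne (measure_mono Set.inter_subset_right))
  filter_upwards [h1, ae_all_iff.2 h.poisson.mem] with ω hω hmem
  exact hω.subset fun k hk => ⟨hmem k, mem_closedBall_zero_iff.2 hk⟩

end

/-- An envelope whose centres depend measurably on `ω` is measurable, once it is replaced by `0` on a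
measurable set outside of which the envelope is a genuine infimum. -/
lemma measurable_envelope {Ω : Type*} [MeasurableSpace Ω] {n : ℕ} {V : Base n → ℝ}
    (hV : Continuous V) (hV0 : ∀ x, 0 ≤ V x) {P : ℕ → Ω → Ambient n} (hP : ∀ k, Measurable (P k))
    {I : Ω → Set ℕ} (hI : ∀ k, MeasurableSet {ω | k ∈ I ω}) {N : Set Ω} (hN : MeasurableSet N)
    [DecidablePred (· ∈ N)] (hne : ∀ ω ∉ N, (I ω).Nonempty)
    (hpos : ∀ ω ∉ N, ∀ k ∈ I ω, 0 ≤ (P k ω).2) (x : Base n) :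
    Measurable fun ω => if ω ∈ N then 0 else envelope V (I ω) (fun k => P k ω) x := by
  refine measurable_of_Iio fun t => ?_
  have : (fun ω => if ω ∈ N then 0 else envelope V (I ω) (fun k => P k ω) x) ⁻¹' Set.Iio t
      = (N ∩ {_ω | 0 < t}) ∪ (Nᶜ ∩ ⋃ k, ({ω | k ∈ I ω} ∩
        {ω | (P k ω).2 + V (x - (P k ω).1) < t})) := by
    ext ω
    by_cases hω : ω ∈ N
    · simp [hω]
    · have := (hne ω hω).to_subtype
      simp only [Set.mem_preimage, hω, if_false, Set.mem_Iio, envelope,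
        ciInf_lt_iff (bddBelow_envelope hV0 (hpos ω hω) x)]
      simp [hω]
  rw [this]
  refine (hN.inter (MeasurableSet.const _)).union (hN.compl.inter (MeasurableSet.iUnion fun k =>
    (hI k).inter (measurableSet_lt ?_ measurable_const)))
  exact (hP k).snd.add (hV.measurable.comp (measurable_const.sub (hP k).fst))

end QEW

end

theorem theorem2 {n : ℕ} (hn : 1 ≤ n) {Ω : Type*} [MeasurableSpace Ω] (μ : Measure Ω)
    [IsProbabilityMeasure μ] (r₀ r₁ : ℝ) (φ : QEW.Ambient n → ℝ)
    (hφ : QEW.IsObstacleShape n r₀ r₁ φ) (lam : ℝ≥0) (P : ℕ → Ω → QEW.Ambient n)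
    (s : ℕ → Ω → ℝ) (hP : QEW.IsObstacleDistribution μ r₁ lam P s) :
    ∃ Fstar : ℝ, 0 < Fstar ∧ ∃ v : QEW.Base n → Ω → ℝ,
      (∀ x ω, 0 ≤ v x ω) ∧ (∀ x, Measurable (v x)) ∧
      ∀ᵐ ω ∂μ,
        Continuous (fun x => v x ω) ∧
        QEW.IsDistribSupersolution (QEW.obstacleField φ P s ω) Fstar (fun x => v x ω) ∧
        QEW.IsViscositySupersolution (QEW.obstacleField φ P s ω) Fstar (fun x => v x ω) ∧
        ∀ F : ℝ, F ≤ Fstar → ∀ T : ℝ, 0 < T → ∀ u : QEW.Base n → ℝ → ℝ,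
          QEW.IsSolution (QEW.obstacleField φ P s ω) F T u → QEW.HasGaussianGrowth T u →
            ∀ x, ∀ t ∈ Set.Icc 0 T, u x t ≤ v x ω := by
  classical
  have hr₀ : 0 < r₀ := (pos_iff_pos_of_mul_pos hφ.sqrt_mul_pos).1
    (Real.sqrt_pos.2 (by exact_mod_cast hn))
  have hr₁ : 0 < r₁ := hφ.sqrt_mul_pos.trans hφ.sqrt_mul_lt
  have hlam : (0 : ℝ) < lam := by exact_mod_cast hP.intensity_pos
  obtain ⟨c, hc, hc2⟩ := hP.exists_strength_lt_le
  -- A box has volume `B`, which makes the closed sites subcritical.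
  have hlog : 0 < Real.log (2 * (2 * n + 1)) := Real.log_pos (by
    have : (0 : ℝ) ≤ n := Nat.cast_nonneg n
    linarith)
  set B : ℝ := 4 / lam * Real.log (2 * (2 * n + 1)) with hB
  have hB0 : 0 < B := by positivity
  obtain ⟨W, ℓ, Fs, h₀, hℓ, hFs, hh₀, hlip, hW, hW', hgap, hin, hout⟩ :=
    QEW.exists_profile hn ((3 * n ^ 2 + 2 * n + 2) * B) hr₀ hc
  have hℓ0 : 0 < ℓ := by linarith
  set hgt : ℝ := B / ℓ ^ n with hhgt
  have hhgt0 : 0 < hgt := by positivity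
  have hBvol : ℓ ^ n * hgt = B := by rw [hhgt]; field_simp
  have hgap' : ∀ x y, ‖x‖ ≤ n * ℓ → 2 * n * ℓ ≤ ‖y‖ →
      W x + (3 * n ^ 2 + 2 * n + 2) * hgt ≤ W y := by
    intro x y hx hy
    have := hgap x y hx hy
    rwa [mul_div_assoc] at this
  set V := QEW.addCone W (hgt * n / ℓ) (2 * n * ℓ + 1) with hV
  have hK : 0 ≤ hgt * n / ℓ := by positivity
  have hV0 : ∀ x, 0 ≤ V x := fun x => (hW x).trans (QEW.le_addCone hK x)
  have hVc : Continuous V := by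
    obtain ⟨L, hL⟩ := hlip
    exact (QEW.lipschitzWith_addCone hL ⟨_, hK⟩).continuous
  set I := QEW.surfaceIndices P s r₁ ℓ hgt c with hI
  have hgood : ∀ᵐ ω ∂μ, (∀ k, 0 < s k ω) ∧ (∀ k, r₁ ≤ (P k ω).2) ∧
      (∀ R : ℕ, {k | ‖P k ω‖ ≤ R}.Finite) ∧
      ∀ z : Fin n → ℤ, {k | QEW.Reachable (QEW.closedSites P s r₁ ℓ hgt c ω) (z, k)}.Finite := by
    have h4 := hP.ae_finite_reachable hℓ0 hhgt0 hc2 (by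
      rw [hBvol, hB]
      refine le_of_eq ?_
      field_simp)
    filter_upwards [ae_all_iff.2 hP.strength_pos, ae_all_iff.2 hP.poisson.mem,
      hP.ae_locallyFinite, h4] with ω h1 h2 h3 h4 using ⟨h1, h2, h3, h4⟩
  obtain ⟨N, hbad, hN, hN0⟩ := exists_measurable_superset_of_null (ae_iff.1 hgood)
  have hgoodN : ∀ ω ∉ N, (∀ k, 0 < s k ω) ∧ (∀ k, r₁ ≤ (P k ω).2) ∧
      (∀ R : ℕ, {k | ‖P k ω‖ ≤ R}.Finite) ∧
      ∀ z : Fin n → ℤ, {k | QEW.Reachable (QEW.closedSites P s r₁ ℓ hgt c ω) (z, k)}.Finite :=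
    fun ω hω => by_contra fun hcon => hω (hbad hcon)
  have hpos : ∀ ω ∉ N, ∀ k ∈ I ω, 0 ≤ (P k ω).2 := fun ω hω k _ =>
    hr₁.le.trans ((hgoodN ω hω).2.1 k)
  refine ⟨Fs / 2, by positivity,
    fun x ω => if ω ∈ N then 0 else QEW.envelope V (I ω) (fun k => P k ω) x, ?_, ?_, ?_⟩
  · intro x ω
    beta_reduce
    split_ifs with hω
    · exact le_rfl
    · exact QEW.envelope_nonneg hV0 (hpos ω hω) x
  · refine QEW.measurable_envelope hVc hV0 hP.poisson.measurable
      hP.measurableSet_mem_surfaceIndices hN (fun ω hω => ?_) hpos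
    obtain ⟨k, hk, -⟩ := QEW.exists_mem_surfaceIndices hn hℓ0 (hgoodN ω hω).2.2.2 0
    exact ⟨k, hk⟩
  · filter_upwards [compl_mem_ae_iff.2 hN0] with ω hω
    obtain ⟨hs, -, hfin, hperc⟩ := hgoodN ω hω
    simp only [if_neg (show ω ∉ N from hω)]
    have hf := hφ.field_nonpos (P := P) hs
    have hstrict := QEW.isStrictSupersolution_envelope (f := QEW.obstacleField φ P s ω)
      (p := fun k => P k ω) (I := I ω) hr₀ hℓ hFs hh₀ hhgt0 hlip hW hW' hgap' hin hout hf
      (fun k hk x y hx hy => by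
        have h1 := hφ.field_le_term hfin hs x y k
        have h2 := hφ.le_neg_one ((x, y) - P k ω)
          (fun i => ((Real.norm_eq_abs _).symm.le.trans
            (PiLp.norm_apply_le (x - (P k ω).1) i)).trans hx) hy
        have h3 : c ≤ s k ω := hk.1
        nlinarith)
      (hpos ω hω) (QEW.exists_mem_surfaceIndices hn hℓ0 hperc)
      (fun k hk k' hk' => QEW.surfaceIndices_height_sub_le hℓ0 hhgt0 hk hk')
    exact ⟨hstrict.continuous,
      hstrict.isDistribSupersolution ((hφ.continuous_field hfin).comp
        (continuous_id.prodMk hstrict.continuous)),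
      hstrict.isViscositySupersolution,
      fun F hF T hT u hu hgrowth => hstrict.solution_le hf hF hT hu hgrowth⟩
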